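/- **Broadcast tree.** For $a,b>0$, the broadcast tree of depth $n$ has a root $\rho$ whose spin $\sigma_\rho$ is uniform on $\{+1,-1\}$; independently, every vertex of depth $<n$ has $\mathrm{Pois}(a/2)$ children of its own spin and $\mathrm{Pois}(b/2)$ children of the opposite spin. **Random model.** One observes the (unordered) topology of the broadcast tree of depth $R$ and the spins of its vertices at depth $R$. Partial recovery is possible if there are $\eta>\frac12$ and estimators $\hat\sigma_R$, functions of the observation, with $\Pr[\hat\sigma_R=\sigma_\rho]\ge\eta$ for all large $R$. **Semirandom model with the cutting adversary.** Put $\varepsilon=\frac{b}{a+b}$, and $\delta=1$ if $\varepsilon\le\frac13$, $\delta=(1-2\varepsilon)^2/\varepsilon^2$ if $\varepsilon\ge\frac13$. Sample the broadcast tree of depth $R+3$. Call a vertex *good* if at least $3$ of its neighbors have degree $\ne2$, and *marked* if it has degree $2$ and both its neighbors are good. Independently for each marked vertex both of whose neighbors have spin opposite to its own, delete both its edges with probability $\delta$. Keep the connected component of the root and remove all vertices of depth $>R$. Finally remove every marked vertex at depth $R$ together with its siblings, which exposes its parent as a leaf. The *leaves* are the remaining vertices at depth $R$ and the vertices at depth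 $R-1$ so exposed. One observes the (unordered) topology of the resulting tree, the good/marked markings of its vertices (as determined before cutting), and the spins of the leaves. The advantage $\Delta(a,b,R)$ is defined by letting $\frac{1+\Delta}{2}$ be the success probability of an optimal estimator of $\sigma_\rho$ from this observation. **Theorem.** For every real $k>1$ there is $0<\varepsilon<\frac12$ with $k(1-2\varepsilon)^2>1$ such that, for $a=2k(1-\varepsilon)$ and $b=2k\varepsilon$, partial recovery is possible in the random model, and yet $\Delta(a,b,R)\to0$ as $R\to\infty$ in the semirandom model with the cutting adversary. -/

import Mathlib

open scoped NNReal ENNReal Topology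

noncomputable section

/-! ### Finite rooted unordered trees -/

/-- Rooted unordered trees of height at most `n` with a label in `α` at every vertex: a root label
together with the multiset of the subtrees hanging from the children of the root.  Two such
labelled trees are equal exactly when they are isomorphic as rooted labelled trees. -/
def LTree (α : Type) : ℕ → Type
  | 0 => α
  | n + 1 => α × Multiset (LTree α n)

namespace LTree

variable {α : Type}

/-- The label of the root. -/
def label : {n : ℕ} → LTree α n → α
  | 0, t => t
  | _ + 1, t => t.1

/-- The number of children of the root. -/
def numChildren : {n : ℕ} → LTree α n → ℕ
  | 0, _ => 0
  | _ + 1, t => Multiset.card t.2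

/-- The multiset of the values `f c`, where `c` runs over the subtrees hanging from the children
of the root. -/
def mapChildren {β : Type} (f : {m : ℕ} → LTree α m → β) : {n : ℕ} → LTree α n → Multiset β
  | 0, _ => 0
  | _ + 1, t => t.2.map f

/-- Remove the bottom level (depth `n + 1`). -/
def dropLevel : {n : ℕ} → LTree α (n + 1) → LTree α n
  | 0, t => t.1
  | _ + 1, t => (t.1, t.2.map dropLevel)

end LTree

/-! ### The broadcast tree -/

/-- `m` independent samples from `p`, as a multiset. -/
def iidMultiset {α : Type} (p : PMF α) : ℕ → PMF (Multiset α)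
  | 0 => PMF.pure 0
  | m + 1 => p.bind fun x => (iidMultiset p m).map fun s => x ::ₘ s

/-- The Poisson distribution with expectation `c`. -/
def poisson (c : ℝ≥0) : PMF ℕ := (ProbabilityTheory.poissonMeasure c).toPMF

/-- The broadcast tree grown until depth `n` from a root of spin `s`: every vertex of depth `< n`
has `Pois(a/2)` children of its own spin and `Pois(b/2)` children of the opposite spin.  In
addition every vertex carries an independent mark drawn from `μ`. -/
def broadcastTree {β : Type} (a b : ℝ≥0) (μ : PMF β) : (n : ℕ) → ℤˣ → PMF (LTree (ℤˣ × β) n)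
  | 0, s => μ.map fun c => (s, c)
  | n + 1, s =>
      μ.bind fun c =>
      (poisson (a / 2)).bind fun i =>
      (poisson (b / 2)).bind fun j =>
      (iidMultiset (broadcastTree a b μ n s) i).bind fun same =>
      (iidMultiset (broadcastTree a b μ n (-s)) j).map fun opp =>
        ((s, c), same + opp)

/-- The uniform distribution on the spins `{+1, -1}`. -/
def uniformSpin : PMF ℤˣ := PMF.uniformOfFintype ℤˣ

/-! ### Recovering the root spin from an observation -/

/-- The probability that the estimator `f` recovers the spin, for a joint law of
(spin, observation). -/
def successProb {Ω : Type} (J : PMF (ℤˣ × Ω)) (f : Ω → ℤˣ) : ℝ≥0∞ :=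
  J.toOuterMeasure {x | f x.2 = x.1}

/-- The advantage `Δ` over random guessing: `(1 + Δ) / 2` is the success probability of an optimal
estimator. -/
def advantage {Ω : Type} (J : PMF (ℤˣ × Ω)) : ℝ :=
  2 * (⨆ f : Ω → ℤˣ, successProb J f).toReal - 1

/-! ### The random model -/

/-- What is observed in the random model: the topology of the tree, and the spins of the vertices
at the bottom level. -/
def leafView {β : Type} : {n : ℕ} → LTree (ℤˣ × β) n → LTree (Option ℤˣ) n
  | 0, t => some t.1
  | _ + 1, t => (none, t.2.map leafView)

/-- Joint law of the root spin and the observation in the random broadcast tree of depth `R`. -/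
def randomModel (a b : ℝ≥0) (R : ℕ) : PMF (ℤˣ × LTree (Option ℤˣ) R) :=
  uniformSpin.bind fun s =>
    (broadcastTree a b (PMF.pure ()) R s).map fun t => (s, leafView t)

/-! ### The cutting adversary

Functions taking `p : Option ParentInfo` work on a vertex of a tree, given the subtree `t` hanging
from it and the relevant data `p` of its parent (`none` if the vertex is the root of the tree).
A vertex label `(s, c)` of the precursor tree consists of the spin `s` and of the coin `c` deciding
whether the adversary cuts at this vertex when it is allowed to. -/

/-- The probability `δ` with which the adversary cuts, as a function of the flip probability. -/
def cutProb (ε : ℝ) : ℝ := if ε ≤ 1 / 3 then 1 else (1 - 2 * ε) ^ 2 / ε ^ 2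

/-- The probability that the child of a vertex has the opposite spin. -/
def flipProb (a b : ℝ≥0) : ℝ≥0 := b / (a + b)

theorem cutProb_le_one {ε : ℝ} (h1 : ε ≤ 1) : cutProb ε ≤ 1 := by
  unfold cutProb
  split_ifs with h
  · exact le_rfl
  · have : (0 : ℝ) < ε := by linarith
    rw [div_le_one (by positivity)]
    nlinarith

theorem flipProb_le_one (a b : ℝ≥0) : flipProb a b ≤ 1 :=
  div_le_one_of_le₀ (by simp) (by simp)

/-- A coin that comes up `true` with probability `δ`. -/
def cutCoin (a b : ℝ≥0) : PMF Bool :=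
  PMF.ofFintype
    (fun c => if c then ENNReal.ofReal (cutProb (flipProb a b))
      else 1 - ENNReal.ofReal (cutProb (flipProb a b)))
    (by
      have h : ENNReal.ofReal (cutProb (flipProb a b)) ≤ 1 := by
        rw [ENNReal.ofReal_le_one]
        exact cutProb_le_one (by exact_mod_cast flipProb_le_one a b)
      simp [h])

/-- Data of the parent of a vertex: its degree, whether it is good, and its spin. -/
structure ParentInfo where
  deg : ℕ
  good : Bool
  spin : ℤˣ

/-- The degree of a vertex in the whole tree. -/
def vertexDegree {α : Type} {n : ℕ} (p : Option ParentInfo) (t : LTree α n) : ℕ :=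
  t.numChildren + if p.isSome then 1 else 0

/-- The multiset of the degrees of the neighbors of a vertex; `d` is the degree of its parent. -/
def nbrDegrees {α : Type} {n : ℕ} (d : Option ℕ) (t : LTree α n) : Multiset ℕ :=
  d.elim 0 (fun x => {x}) + t.mapChildren (fun c => c.numChildren + 1)

/-- A vertex is good if at least three of its neighbors have degree not equal to `2`. -/
def isGood {α : Type} {n : ℕ} (d : Option ℕ) (t : LTree α n) : Bool :=
  decide (3 ≤ (nbrDegrees d t).countP (· ≠ 2))

/-- Which of the neighbors of a vertex are good. -/
def nbrGood {α : Type} {n : ℕ} (p : Option ParentInfo) (t : LTree α n) : Multiset Bool :=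
  p.elim 0 (fun x => {x.good}) + t.mapChildren (isGood (some (vertexDegree p t)))

/-- The spins of the neighbors of a vertex. -/
def nbrSpins {n : ℕ} (p : Option ParentInfo) (t : LTree (ℤˣ × Bool) n) : Multiset ℤˣ :=
  p.elim 0 (fun x => {x.spin}) + t.mapChildren (fun c => c.label.1)

/-- A vertex is marked if it has degree `2` and both of its neighbors are good. -/
def isMarked {α : Type} {n : ℕ} (p : Option ParentInfo) (t : LTree α n) : Bool :=
  decide (vertexDegree p t = 2 ∧ ∀ g ∈ nbrGood p t, g = true)

/-- The adversary cuts at a vertex, i.e. deletes both its edges, if the vertex is marked, both of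
its neighbors have the opposite spin, and its coin says so. -/
def isCut {n : ℕ} (p : Option ParentInfo) (t : LTree (ℤˣ × Bool) n) : Bool :=
  isMarked p t && decide (∀ s ∈ nbrSpins p t, s = -t.label.1) && t.label.2

/-- The label of a vertex after the action of the adversary. -/
structure VertexData where
  spin : ℤˣ
  good : Bool
  marked : Bool
  cut : Bool

/-- The data of a vertex. -/
def vertexData {n : ℕ} (p : Option ParentInfo) (t : LTree (ℤˣ × Bool) n) : VertexData where
  spin := t.label.1
  good := isGood (p.map ParentInfo.deg) t
  marked := isMarked p t
  cut := isCut p t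

/-- The data of a vertex that its children need. -/
def infoForChildren {n : ℕ} (p : Option ParentInfo) (t : LTree (ℤˣ × Bool) n) : ParentInfo where
  deg := vertexDegree p t
  good := isGood (p.map ParentInfo.deg) t
  spin := t.label.1

/-- Compute the data of all vertices. -/
def annotate : {n : ℕ} → Option ParentInfo → LTree (ℤˣ × Bool) n → LTree VertexData n
  | 0, p, t => vertexData (n := 0) p t
  | n + 1, p, t =>
      (vertexData (n := n + 1) p t,
        t.2.map (annotate (some (infoForChildren (n := n + 1) p t))))

/-- Delete the edges incident to cut vertices and keep the connected component of the root: the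
edge from a vertex to its child survives iff neither of the two is cut. -/
def component : {n : ℕ} → LTree VertexData n → LTree VertexData n
  | 0, t => t
  | _ + 1, t =>
      (t.1, (t.2.filter fun c => t.1.cut = false ∧ c.label.cut = false).map component)

/-- What is observed at a vertex: the markings, and the spin if the vertex is a leaf. -/
structure VertexView where
  good : Bool
  marked : Bool
  leafSpin : Option ℤˣ

/-- What is observed at a leaf. -/
def VertexData.viewLeaf (x : VertexData) : VertexView := ⟨x.good, x.marked, some x.spin⟩

/-- What is observed at a vertex that is not a leaf. -/
def VertexData.viewInner (x : VertexData) : VertexView := ⟨x.good, x.marked, none⟩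

/-- The observed tree.  In a tree of height `R` the vertices at depth `R` are leaves, except that a
marked vertex at depth `R` is removed along with its siblings, which exposes the parent (at depth
`R - 1`) as a leaf. -/
def observe : {n : ℕ} → LTree VertexData n → LTree VertexView n
  | 0, t => VertexData.viewLeaf t
  | 1, t =>
      if true ∈ t.2.map (fun c => (LTree.label c).marked) then (t.1.viewLeaf, 0)
      else (t.1.viewInner, t.2.map observe)
  | _ + 2, t => (t.1.viewInner, t.2.map observe)

/-- What the adversary and the trimming make of the precursor tree: compute markings and cuts, keep
the component of the root, remove the vertices of depth greater than `R`, and observe. -/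
def adversaryView {R : ℕ} (t : LTree (ℤˣ × Bool) (R + 3)) : LTree VertexView R :=
  observe (component (annotate none t)).dropLevel.dropLevel.dropLevel

/-- Joint law of the root spin and the observation in the semirandom broadcast tree with parameters
`a`, `b` and depth `R`, under the cutting adversary. -/
def semirandomModel (a b : ℝ≥0) (R : ℕ) : PMF (ℤˣ × LTree VertexView R) :=
  uniformSpin.bind fun s =>
    (broadcastTree a b (cutCoin a b) (R + 3) s).map fun t => (s, adversaryView t)

end

/-! Write θ = 1 - 2ε. A broadcast tree is a `Pois(k)` Galton–Watson tree on which every edge flips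
the spin with probability ε (`broadcastTree_eq_bind_spinLaw`, by Poisson thinning). In the random
model, kθ² > 1 makes the variance of the sum of the leaf spins comparable to its squared mean, and a
second moment argument bounds the success of the likelihood test away from 1/2.

For the semirandom model, information about a uniform spin is measured by the second moment of its
posterior mean, equivalently by the drop of the least mean squared error below 1 (`InfoLE`). It
bounds the square of the advantage, it is at most additive over conditionally independent
observations (`InfoLE.prod`), and an edge multiplies it by at most θ²
(`infoLE_childLaw_of_not_isMarked`). These facts alone give at most (kθ²)^R up to a constant, which
is the Kesten–Stigum bound.

The adversary improves on this at marked vertices. With x = δε² = min(ε, θ)², the two edges at a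
marked vertex, taken together, contract information by (θ² - x)²/(1 - x) instead of θ⁴
(`infoLE_childLaw_of_isMarked`). A cut happens with the same probability for either spin, so seeing
it teaches nothing, and it removes precisely cases in which the two neighbors agree. The new factor
is smaller than θ⁴ by a definite proportion (`noise_identity`).

Markings depend on the topology alone. So, given the topology, the information is at most a sum over
paths, in which each marked vertex met contributes an extra factor Q < 1 (`infoLE_viewLaw`,
`infoLE_viewLaw_root`). A fixed finite shape that forces a mark, `Topo.gadget`, has positive
probability. Looking for it at every third level, the expected sum grows per three levels by at most
(kθ²)³ minus a positive quantity (`expect_gadgetWeight_step`). At kθ² = 1 this is below 1, and by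
continuity it stays below 1 for some ε with kθ² > 1 (`exists_flip_probability`). -/

noncomputable section

/-! ### Expectations of nonnegative functions -/

/-- The expectation of a nonnegative function. -/
def expect {α : Type} (p : PMF α) (g : α → ℝ≥0∞) : ℝ≥0∞ := ∑' x, p x * g x

section Expect

variable {α β : Type}

theorem expect_bind (p : PMF α) (q : α → PMF β) (g : β → ℝ≥0∞) :
    expect (p.bind q) g = expect p fun x => expect (q x) g := by
  simp only [expect, PMF.bind_apply, ← ENNReal.tsum_mul_right, ← ENNReal.tsum_mul_left]
  rw [ENNReal.tsum_comm]
  simp only [mul_assoc]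

@[simp]
theorem expect_pure (a : α) (g : α → ℝ≥0∞) : expect (PMF.pure a) g = g a := by
  rw [expect, tsum_eq_single a]
  · simp
  · intro b hb
    simp [hb]

theorem expect_map (p : PMF α) (f : α → β) (g : β → ℝ≥0∞) :
    expect (p.map f) g = expect p fun x => g (f x) := by
  simp [← PMF.bind_pure_comp, expect_bind]

theorem expect_mono (p : PMF α) {g h : α → ℝ≥0∞} (H : ∀ x, g x ≤ h x) :
    expect p g ≤ expect p h :=
  ENNReal.tsum_le_tsum fun x => mul_le_mul_right (H x) _

theorem expect_add (p : PMF α) (g h : α → ℝ≥0∞) :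
    expect p (fun x => g x + h x) = expect p g + expect p h := by
  simp only [expect, mul_add, ENNReal.tsum_add]

theorem expect_const_mul (p : PMF α) (c : ℝ≥0∞) (g : α → ℝ≥0∞) :
    expect p (fun x => c * g x) = c * expect p g := by
  simp only [expect, ← ENNReal.tsum_mul_left]
  exact tsum_congr fun x => by ring

@[simp]
theorem expect_const (p : PMF α) (c : ℝ≥0∞) : expect p (fun _ => c) = c := by
  simp [expect, ENNReal.tsum_mul_right, p.tsum_coe]

theorem expect_sum (p : PMF α) {ι : Type} (s : Finset ι) (g : ι → α → ℝ≥0∞) :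
    expect p (fun x => ∑ i ∈ s, g i x) = ∑ i ∈ s, expect p (g i) := by
  classical
  induction s using Finset.induction_on with
  | empty => simp
  | insert i s hi ih => simp only [Finset.sum_insert hi, expect_add, ih]

theorem expect_comm (p : PMF α) (q : PMF β) (g : α → β → ℝ≥0∞) :
    (expect p fun x => expect q fun y => g x y) = expect q fun y => expect p fun x => g x y := by
  simp only [expect, ← ENNReal.tsum_mul_left]
  rw [ENNReal.tsum_comm]
  exact tsum_congr fun y => tsum_congr fun x => by ring

theorem expect_congr {p : PMF α} {g h : α → ℝ≥0∞} (H : ∀ x ∈ p.support, g x = h x) :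
    expect p g = expect p h := by
  refine tsum_congr fun x => ?_
  by_cases hx : p x = 0
  · simp [hx]
  · rw [H x ((p.mem_support_iff x).2 hx)]

theorem pmf_ext_expect {p q : PMF α} (H : ∀ g, expect p g = expect q g) : p = q := by
  classical
  ext a
  have := H (fun x => if x = a then 1 else 0)
  simpa [expect] using this

theorem pmf_map_congr {p : PMF α} {f g : α → β} (H : ∀ x ∈ p.support, f x = g x) :
    p.map f = p.map g :=
  pmf_ext_expect fun k => by
    rw [expect_map, expect_map]
    exact expect_congr fun x hx => by rw [H x hx]

end Expect

/-- The random choice of `x` with probability `p` and `y` with probability `q`. -/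
def twoPoint {α : Type} (p q : ℝ≥0∞) (h : p + q = 1) (x y : α) : PMF α :=
  (PMF.ofFintype (fun b : Bool => cond b p q) (by simpa using h)).map fun b => cond b x y

theorem expect_twoPoint {α : Type} {p q : ℝ≥0∞} (h : p + q = 1) (x y : α) (g : α → ℝ≥0∞) :
    expect (twoPoint p q h x y) g = p * g x + q * g y := by
  rw [twoPoint, expect_map]
  simp [expect, tsum_fintype]

/-! ### The quadratic risk of estimating a spin -/

/-- Twice the mean squared error of the estimator `h` of a uniform spin observed through `K`. -/
def quadRisk {Ω : Type} (K : ℤˣ → PMF Ω) (h : Ω → ℝ) : ℝ≥0∞ :=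
  expect (K 1) (fun x => ENNReal.ofReal ((1 - h x) ^ 2)) +
    expect (K (-1)) (fun x => ENNReal.ofReal ((1 + h x) ^ 2))

/-- The observation channel `K` carries at most `w` units of `χ²`-information about a uniform
spin: no estimator has a mean squared error smaller than `1 - w`. -/
def InfoLE {Ω : Type} (K : ℤˣ → PMF Ω) (w : ℝ≥0∞) : Prop :=
  ∀ h : Ω → ℝ, 2 ≤ 2 * w + quadRisk K h

section InfoLE

variable {Ω Ω' : Type}

theorem InfoLE.mono {K : ℤˣ → PMF Ω} {w w' : ℝ≥0∞} (H : InfoLE K w) (hw : w ≤ w') :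
    InfoLE K w' := fun h =>
  (H h).trans (by gcongr)

theorem infoLE_of_one_le (K : ℤˣ → PMF Ω) {w : ℝ≥0∞} (hw : 1 ≤ w) : InfoLE K w := fun h =>
  calc (2 : ℝ≥0∞) = 2 * 1 := by norm_num
    _ ≤ 2 * w := by gcongr
    _ ≤ _ := le_self_add

theorem InfoLE.map {K : ℤˣ → PMF Ω} {w : ℝ≥0∞} (H : InfoLE K w) (f : Ω → Ω') :
    InfoLE (fun s => (K s).map f) w := fun h => by
  simpa only [quadRisk, expect_map] using H fun x => h (f x)

theorem ofReal_sq_add_sq_ge (x : ℝ) :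
    2 ≤ ENNReal.ofReal ((1 - x) ^ 2) + ENNReal.ofReal ((1 + x) ^ 2) := by
  rw [← ENNReal.ofReal_add (by positivity) (by positivity)]
  rw [show (2 : ℝ≥0∞) = ENNReal.ofReal 2 by simp]
  exact ENNReal.ofReal_le_ofReal (by nlinarith [sq_nonneg x])

theorem infoLE_const (p : PMF Ω) : InfoLE (fun _ => p) 0 := fun h => by
  rw [quadRisk, ← expect_add]
  calc (2 : ℝ≥0∞) = expect p fun _ => 2 := by simp
    _ ≤ _ := expect_mono _ fun x => ofReal_sq_add_sq_ge (h x)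
    _ ≤ _ := le_add_self

/-- The risk of a fixed estimator is affine in the channel, so the bounds average. The index `i` may
stay hidden. Here it will be the topology, and its law does not depend on the spin. -/
theorem InfoLE.bind {ι : Type} (p : PMF ι) {K : ι → ℤˣ → PMF Ω} {w : ι → ℝ≥0∞}
    (H : ∀ i, InfoLE (K i) (w i)) :
    InfoLE (fun s => p.bind fun i => K i s) (expect p w) := fun h => by
  simp only [quadRisk, expect_bind]
  rw [← expect_add, ← expect_const_mul, ← expect_add]
  calc (2 : ℝ≥0∞) = expect p fun _ => 2 := by simp
    _ ≤ _ := expect_mono _ fun i => H i h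

/-- Passing a channel through a noisy channel that keeps the spin with weight `A`, flips it with
weight `B`, and otherwise returns an uninformative symbol. -/
theorem InfoLE.noisy {K L : ℤˣ → PMF Ω} {w : ℝ≥0∞} (H : InfoLE L w)
    {J : ℤˣ → (Ω → ℝ≥0∞) → ℝ≥0∞} {A B : ℝ} (hA : 0 ≤ A) (hB : 0 ≤ B) (hAB : 0 < A + B)
    (hJ : ∀ h : Ω → ℝ, ENNReal.ofReal (2 * (1 - A - B)) ≤
      J 1 (fun x => ENNReal.ofReal ((1 - h x) ^ 2)) +
        J (-1) (fun x => ENNReal.ofReal ((1 + h x) ^ 2)))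
    (hK : ∀ s g, expect (K s) g = J s g + ENNReal.ofReal A * expect (L s) g
      + ENNReal.ofReal B * expect (L (-s)) g) :
    InfoLE K (ENNReal.ofReal ((A - B) ^ 2 / (A + B)) * w) := by
  intro h
  -- `t` is the correlation between input and output given that the symbol is informative.
  -- Completing the square, A(1 - y)² + B(1 + y)² = (A + B)((1 - t²) + (t - y)²). The first summand
  -- is unavoidable risk, and the second is `t²` times the risk of the estimator `h / t` for `L`.
  set t := (A - B) / (A + B) with ht
  have ht1 : t ^ 2 ≤ 1 := by
    rw [ht, div_pow, div_le_one (by positivity)]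
    nlinarith [mul_nonneg hA hB]
  have hABt : A - B = (A + B) * t := by rw [ht]; field_simp
  have key : ENNReal.ofReal (2 * (A + B)) ≤ 2 * (ENNReal.ofReal ((A - B) ^ 2 / (A + B)) * w) +
      ((ENNReal.ofReal A * expect (L 1) (fun x => ENNReal.ofReal ((1 - h x) ^ 2))
        + ENNReal.ofReal B * expect (L (-1)) (fun x => ENNReal.ofReal ((1 - h x) ^ 2)))
      + (ENNReal.ofReal A * expect (L (-1)) (fun x => ENNReal.ofReal ((1 + h x) ^ 2))
        + ENNReal.ofReal B * expect (L 1) (fun x => ENNReal.ofReal ((1 + h x) ^ 2)))) := by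
    have e1 : (A - B) ^ 2 / (A + B) = (A + B) * t ^ 2 := by rw [ht]; field_simp
    have id1 : ∀ y : ℝ, A * (1 - y) ^ 2 + B * (1 + y) ^ 2
        = (A + B) * (1 - t ^ 2) + (A + B) * (t - y) ^ 2 := fun y => by
      linear_combination (-2 * y) * hABt
    have id2 : ∀ y : ℝ, B * (1 - y) ^ 2 + A * (1 + y) ^ 2
        = (A + B) * (1 - t ^ 2) + (A + B) * (t + y) ^ 2 := fun y => by
      linear_combination (2 * y) * hABt
    have c0 : 0 ≤ (A + B) * (1 - t ^ 2) := mul_nonneg hAB.le (by linarith)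
    have r1 : ENNReal.ofReal A * expect (L 1) (fun x => ENNReal.ofReal ((1 - h x) ^ 2))
        + ENNReal.ofReal B * expect (L 1) (fun x => ENNReal.ofReal ((1 + h x) ^ 2))
        = ENNReal.ofReal ((A + B) * (1 - t ^ 2))
          + ENNReal.ofReal (A + B) * expect (L 1) (fun x => ENNReal.ofReal ((t - h x) ^ 2)) := by
      rw [← expect_const (L 1) (ENNReal.ofReal ((A + B) * (1 - t ^ 2)))]
      simp only [← expect_const_mul, ← expect_add]
      congr 1; funext x
      rw [← ENNReal.ofReal_mul hA, ← ENNReal.ofReal_mul hB, ← ENNReal.ofReal_mul hAB.le,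
        ← ENNReal.ofReal_add (by positivity) (by positivity),
        ← ENNReal.ofReal_add (by positivity) (by positivity), id1]
    have r2 : ENNReal.ofReal B * expect (L (-1)) (fun x => ENNReal.ofReal ((1 - h x) ^ 2))
        + ENNReal.ofReal A * expect (L (-1)) (fun x => ENNReal.ofReal ((1 + h x) ^ 2))
        = ENNReal.ofReal ((A + B) * (1 - t ^ 2))
          + ENNReal.ofReal (A + B) * expect (L (-1)) (fun x => ENNReal.ofReal ((t + h x) ^ 2)) := by
      rw [← expect_const (L (-1)) (ENNReal.ofReal ((A + B) * (1 - t ^ 2)))]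
      simp only [← expect_const_mul, ← expect_add]
      congr 1; funext x
      rw [← ENNReal.ofReal_mul hA, ← ENNReal.ofReal_mul hB, ← ENNReal.ofReal_mul hAB.le,
        ← ENNReal.ofReal_add (by positivity) (by positivity),
        ← ENNReal.ofReal_add (by positivity) (by positivity), id2]
    have r3 : ENNReal.ofReal (t ^ 2) * 2 ≤ ENNReal.ofReal (t ^ 2) * (2 * w)
        + (expect (L 1) (fun x => ENNReal.ofReal ((t - h x) ^ 2))
          + expect (L (-1)) (fun x => ENNReal.ofReal ((t + h x) ^ 2))) := by
      by_cases h0 : t = 0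
      · simp [h0]
      · have := mul_le_mul_right (H fun x => h x / t) (ENNReal.ofReal (t ^ 2))
        rw [mul_add, quadRisk, mul_add, ← expect_const_mul, ← expect_const_mul] at this
        convert this using 4
        · funext x
          rw [← ENNReal.ofReal_mul (by positivity)]
          congr 1; field_simp
        · funext x
          rw [← ENNReal.ofReal_mul (by positivity)]
          congr 1; field_simp
    have r4 := mul_le_mul_right r3 (ENNReal.ofReal (A + B))
    have r5 : ENNReal.ofReal (2 * (A + B)) = 2 * ENNReal.ofReal ((A + B) * (1 - t ^ 2))
        + ENNReal.ofReal (A + B) * (ENNReal.ofReal (t ^ 2) * 2) := by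
      rw [show (2 : ℝ≥0∞) = ENNReal.ofReal 2 by simp, ← ENNReal.ofReal_mul (by positivity),
        ← ENNReal.ofReal_mul (by positivity), ← ENNReal.ofReal_mul hAB.le,
        ← ENNReal.ofReal_add (by positivity) (by positivity)]
      congr 1; ring
    calc ENNReal.ofReal (2 * (A + B)) ≤ 2 * ENNReal.ofReal ((A + B) * (1 - t ^ 2))
        + ENNReal.ofReal (A + B) * (ENNReal.ofReal (t ^ 2) * (2 * w)
        + (expect (L 1) (fun x => ENNReal.ofReal ((t - h x) ^ 2))
          + expect (L (-1)) (fun x => ENNReal.ofReal ((t + h x) ^ 2)))) := by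
          rw [r5]; gcongr
      _ = 2 * (ENNReal.ofReal ((A - B) ^ 2 / (A + B)) * w) +
          ((ENNReal.ofReal ((A + B) * (1 - t ^ 2))
          + ENNReal.ofReal (A + B) * expect (L 1) (fun x => ENNReal.ofReal ((t - h x) ^ 2)))
          + (ENNReal.ofReal ((A + B) * (1 - t ^ 2))
          + ENNReal.ofReal (A + B) * expect (L (-1)) (fun x => ENNReal.ofReal ((t + h x) ^ 2))))
           := by
          rw [e1, ENNReal.ofReal_mul (q := t ^ 2) hAB.le]; ring
      _ = _ := by
          rw [← r1, ← r2]; ring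
  rw [quadRisk, hK, hK, neg_neg]
  have hle : (2 : ℝ≥0∞) ≤ ENNReal.ofReal (2 * (1 - A - B)) + ENNReal.ofReal (2 * (A + B)) := by
    rw [show (2 : ℝ≥0∞) = ENNReal.ofReal (2 * (1 - A - B) + 2 * (A + B)) by ring_nf; simp]
    exact ENNReal.ofReal_add_le
  refine hle.trans ((add_le_add (hJ h) key).trans (le_of_eq ?_))
  ring

end InfoLE

/-! ### Independent observations -/

theorem hasSum_pmf {α : Type} (p : PMF α) : HasSum (fun x => (p x).toReal) 1 := by
  have h := p.tsum_coe
  have hs : Summable fun x => (p x).toReal := ENNReal.summable_toReal (by simp [h])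
  have := hs.hasSum
  rwa [← ENNReal.tsum_toReal_eq (fun x => p.apply_ne_top x), h, ENNReal.toReal_one] at this

/-- The minorant may change sign. The majorant need not be summable, since estimators may be
unbounded; in that case the right side is infinite. -/
theorem ofReal_hasSum_le_tsum {α : Type} {g g' : α → ℝ} {G : ℝ} (hg : HasSum g G)
    (hle : ∀ x, g x ≤ g' x) (h0 : ∀ x, 0 ≤ g' x) :
    ENNReal.ofReal G ≤ ∑' x, ENNReal.ofReal (g' x) := by
  by_cases hs : Summable g'
  · rw [← ENNReal.ofReal_tsum_of_nonneg h0 hs]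
    exact ENNReal.ofReal_le_ofReal (hasSum_le hle hg hs.hasSum)
  · have : ∑' x, ENNReal.ofReal (g' x) = ∞ := by
      by_contra hne
      apply hs
      have := ENNReal.summable_toReal hne
      simpa [ENNReal.toReal_ofReal, h0] using this
    simp [this]

/-- The part of the quadratic risk carried by a pair of posterior means is bounded below by
an expression that factorizes. -/
theorem posterior_pair_bound {m₁ m₂ a b h : ℝ} (hm₁ : 0 ≤ m₁) (hm₂ : 0 ≤ m₂) (ha : a ^ 2 ≤ 1)
    (hb : b ^ 2 ≤ 1) :
    2 * ((m₁ * (1 - a ^ 2)) * (m₂ * (1 - b ^ 2))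
        - (m₁ * (1 - a ^ 2) * a) * (m₂ * (1 - b ^ 2) * b)) ≤
      (m₁ * (1 + a)) * (m₂ * (1 + b)) * (1 - h) ^ 2
        + (m₁ * (1 - a)) * (m₂ * (1 - b)) * (1 + h) ^ 2 := by
  have ha' := abs_le.1 ((sq_le_one_iff_abs_le_one a).1 ha)
  have hb' := abs_le.1 ((sq_le_one_iff_abs_le_one b).1 hb)
  -- Minimizing the right side over `h` gives 2(1 - a²)(1 - b²)/(1 + ab). Replacing 1/(1 + ab) by
  -- the smaller 1 - ab makes the bound a difference of products of one-variable functions.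
  have main : 2 * ((1 - a ^ 2) * (1 - b ^ 2) * (1 - a * b)) ≤
      (1 + a) * (1 + b) * (1 - h) ^ 2 + (1 - a) * (1 - b) * (1 + h) ^ 2 := by
    have hpos : 0 ≤ 1 + a * b := by nlinarith
    rcases hpos.eq_or_lt with h0 | h0
    · have hab : (a * b) ^ 2 = 1 := by
        have : a * b = -1 := by linarith
        rw [this]; norm_num
      have ha1 : a ^ 2 = 1 := by nlinarith
      rw [ha1]
      have := mul_nonneg (mul_nonneg (by linarith : 0 ≤ 1 + a) (by linarith : 0 ≤ 1 + b))
        (sq_nonneg (1 - h))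
      have := mul_nonneg (mul_nonneg (by linarith : 0 ≤ 1 - a) (by linarith : 0 ≤ 1 - b))
        (sq_nonneg (1 + h))
      linarith
    · refine le_of_mul_le_mul_left ?_ h0
      have h1 : 0 ≤ (1 - a ^ 2) * (1 - b ^ 2) := mul_nonneg (by linarith) (by linarith)
      nlinarith [sq_nonneg ((1 + a * b) * h - (a + b)), mul_nonneg h1 (sq_nonneg (a * b))]
  have := mul_le_mul_of_nonneg_left main (mul_nonneg hm₁ hm₂)
  linarith

/-- The overlap `H` of the two laws of a channel, and a bound for the third moment of the posterior
mean. -/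
theorem exists_posterior {Ω : Type} (K : ℤˣ → PMF Ω) : ∃ (m a : Ω → ℝ) (H V : ℝ),
    (∀ x, 0 ≤ m x) ∧ (∀ x, a x ^ 2 ≤ 1) ∧
    (∀ x, (K 1 x).toReal = m x * (1 + a x)) ∧ (∀ x, (K (-1) x).toReal = m x * (1 - a x)) ∧
    HasSum (fun x => m x * (1 - a x ^ 2)) H ∧ HasSum (fun x => m x * (1 - a x ^ 2) * a x) V ∧
    |V| ≤ 1 - H := by
  set p : Ω → ℝ := fun x => (K 1 x).toReal with hp
  set q : Ω → ℝ := fun x => (K (-1) x).toReal with hq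
  have hp0 : ∀ x, 0 ≤ p x := fun x => ENNReal.toReal_nonneg
  have hq0 : ∀ x, 0 ≤ q x := fun x => ENNReal.toReal_nonneg
  have hps : HasSum p 1 := hasSum_pmf _
  have hqs : HasSum q 1 := hasSum_pmf _
  -- `m` is the law of the observation under a uniform spin and `a` is the posterior mean. Where `m`
  -- vanishes, division by zero makes `a` zero, which is harmless.
  let m : Ω → ℝ := fun x => (p x + q x) / 2
  let a : Ω → ℝ := fun x => (p x - q x) / (p x + q x)
  have hm0 : ∀ x, 0 ≤ m x := fun x => by have := hp0 x; have := hq0 x; positivity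
  have ha1 : ∀ x, a x ^ 2 ≤ 1 := fun x => by
    have := hp0 x; have := hq0 x
    rw [div_pow]
    refine div_le_one_of_le₀ ?_ (by positivity)
    nlinarith [mul_nonneg (hp0 x) (hq0 x)]
  have hma : ∀ x, m x * a x = (p x - q x) / 2 := fun x => by
    by_cases h : p x + q x = 0
    · have h1 : p x = 0 := by linarith [hp0 x, hq0 x]
      have h2 : q x = 0 := by linarith [hp0 x, hq0 x]
      simp only [m, a, h1, h2]; simp
    · simp only [m, a]; field_simp
  have hm : HasSum m 1 := by simpa using (hps.add hqs).div_const 2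
  have hmas : HasSum (fun x => m x * a x) 0 := by
    simp only [hma]; simpa using (hps.sub hqs).div_const 2
  have habs : ∀ x, |a x| ≤ 1 := fun x => (sq_le_one_iff_abs_le_one _).1 (ha1 x)
  have s2 : Summable fun x => m x * a x ^ 2 := by
    refine Summable.of_nonneg_of_le (fun x => mul_nonneg (hm0 x) (sq_nonneg _)) (fun x => ?_)
      hm.summable
    exact mul_le_of_le_one_right (hm0 x) (ha1 x)
  have hb3 : ∀ x, |m x * a x ^ 3| ≤ m x * a x ^ 2 := fun x => by
    rw [abs_mul, abs_of_nonneg (hm0 x), abs_pow, pow_succ, sq_abs]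
    exact mul_le_mul_of_nonneg_left (mul_le_of_le_one_right (sq_nonneg _) (habs x)) (hm0 x)
  have s3 : Summable fun x => m x * a x ^ 3 :=
    Summable.of_norm_bounded s2 fun x => by simpa using hb3 x
  -- The posterior mean has expectation zero, so `V` is minus its third moment. As `|a| ≤ 1`, this
  -- is at most the second moment 1 - H in absolute value.
  refine ⟨m, a, 1 - ∑' x, m x * a x ^ 2, 0 - ∑' x, m x * a x ^ 3, hm0, ha1, ?_, ?_, ?_, ?_, ?_⟩
  · intro x; rw [mul_add, hma]; simp only [m]; ring
  · intro x; rw [mul_sub, hma]; simp only [m]; ring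
  · exact (hm.sub s2.hasSum).congr_fun fun x => by ring
  · exact (hmas.sub s3.hasSum).congr_fun fun x => by ring
  · rw [zero_sub, abs_neg, sub_sub_cancel]
    refine (abs_le.2 ⟨?_, ?_⟩)
    · rw [← tsum_neg]
      exact s2.neg.tsum_le_tsum (fun x => neg_le_of_abs_le (hb3 x)) s3
    · exact s3.tsum_le_tsum (fun x => le_of_abs_le (hb3 x)) s2

/-- The hypothesis is tested on the optimal estimator, the posterior mean `a`, whose risk is 2H
because (1 + a)(1 - a)² + (1 - a)(1 + a)² = 2(1 - a²). -/
theorem InfoLE.one_le_add_overlap {Z : Type} {M : ℤˣ → PMF Z} {u : ℝ≥0} {m a : Z → ℝ} {H : ℝ}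
    (hM : InfoLE M u) (hm : ∀ x, 0 ≤ m x) (ha : ∀ x, a x ^ 2 ≤ 1)
    (hp : ∀ x, (M 1 x).toReal = m x * (1 + a x)) (hq : ∀ x, (M (-1) x).toReal = m x * (1 - a x))
    (hH : HasSum (fun x => m x * (1 - a x ^ 2)) H) : 1 ≤ u + H := by
  have h1 := hM a
  have e : quadRisk M a = ENNReal.ofReal (2 * H) := by
    rw [quadRisk, expect, expect, ← ENNReal.tsum_add, ← (hH.mul_left 2).tsum_eq,
      ENNReal.ofReal_tsum_of_nonneg _ (hH.mul_left 2).summable]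
    · refine tsum_congr fun x => ?_
      rw [← ENNReal.ofReal_toReal ((M 1).apply_ne_top x),
        ← ENNReal.ofReal_toReal ((M (-1)).apply_ne_top x),
        ← ENNReal.ofReal_mul ENNReal.toReal_nonneg, ← ENNReal.ofReal_mul ENNReal.toReal_nonneg,
        ← ENNReal.ofReal_add (by positivity) (by positivity), hp, hq]
      congr 1; ring
    · intro x
      have := hm x; have := ha x
      exact mul_nonneg zero_le_two (mul_nonneg (hm x) (by linarith))
  have hH0 : 0 ≤ H := hH.nonneg fun x => mul_nonneg (hm x) (by linarith [ha x])
  rw [e, ← ENNReal.ofReal_coe_nnreal, show (2 : ℝ≥0∞) = ENNReal.ofReal 2 by simp,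
    ← ENNReal.ofReal_mul (by positivity), ← ENNReal.ofReal_add (by positivity) (by positivity),
    ENNReal.ofReal_le_ofReal_iff (by positivity)] at h1
  linarith

theorem hasSum_prod_mul {X Y : Type} {f : X → ℝ} {g : Y → ℝ} {F G : ℝ} (hf : HasSum f F)
    (hg : HasSum g G) : HasSum (fun z : X × Y => f z.1 * g z.2) (F * G) :=
  hf.mul hg (summable_mul_of_summable_norm (f := f) (g := g) hf.summable.norm hg.summable.norm)

/-- The two informations are exactly 1 - H and 1 - H'. By `posterior_pair_bound` every joint
estimator has risk at least 2(HH' - VV'), and VV' ≤ (1 - H)(1 - H') turns this into 2(H + H' - 1).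
Hence the joint information is at most (1 - H) + (1 - H'). -/
theorem InfoLE.prod {X Y : Type} {K : ℤˣ → PMF X} {L : ℤˣ → PMF Y} {w v : ℝ≥0∞}
    (hK : InfoLE K w) (hL : InfoLE L v) :
    InfoLE (fun s => (K s).bind fun x => (L s).map fun y => (x, y)) (w + v) := by
  intro h
  rcases eq_or_ne w ∞ with rfl | hw
  · simp
  rcases eq_or_ne v ∞ with rfl | hv
  · simp
  lift w to ℝ≥0 using hw
  lift v to ℝ≥0 using hv
  obtain ⟨m, a, H, V, hm, ha, hp, hq, hH, hV, hVH⟩ := exists_posterior K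
  obtain ⟨m', a', H', V', hm', ha', hp', hq', hH', hV', hVH'⟩ := exists_posterior L
  have h1 := hK.one_le_add_overlap hm ha hp hq hH
  have h2 := hL.one_le_add_overlap hm' ha' hp' hq' hH'
  have hprod : HasSum (fun z : X × Y => 2 * ((m z.1 * (1 - a z.1 ^ 2)) * (m' z.2 * (1 - a' z.2 ^ 2))
      - (m z.1 * (1 - a z.1 ^ 2) * a z.1) * (m' z.2 * (1 - a' z.2 ^ 2) * a' z.2)))
      (2 * (H * H' - V * V')) := by
    refine HasSum.mul_left 2 (HasSum.sub ?_ ?_)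
    · exact hasSum_prod_mul (f := fun x => m x * (1 - a x ^ 2))
        (g := fun y => m' y * (1 - a' y ^ 2)) hH hH'
    · exact hasSum_prod_mul (f := fun x => m x * (1 - a x ^ 2) * a x)
        (g := fun y => m' y * (1 - a' y ^ 2) * a' y) hV hV'
  have hrisk : ENNReal.ofReal (2 * (H * H' - V * V')) ≤
      quadRisk (fun s => (K s).bind fun x => (L s).map fun y => (x, y)) h := by
    refine (ofReal_hasSum_le_tsum hprod (fun z => posterior_pair_bound (h := h z) (hm z.1) (hm' z.2)
      (ha z.1) (ha' z.2)) fun z => ?_).trans (le_of_eq ?_)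
    · rw [← hp, ← hp', ← hq, ← hq']
      positivity
    · simp only [quadRisk, expect_bind, expect_map]
      simp only [expect, ← ENNReal.tsum_mul_left]
      rw [ENNReal.tsum_prod', ← ENNReal.tsum_add]
      refine tsum_congr fun x => ?_
      rw [← ENNReal.tsum_add]
      refine tsum_congr fun y => ?_
      rw [← hp, ← hp', ← hq, ← hq', ENNReal.ofReal_add (by positivity) (by positivity),
        ENNReal.ofReal_mul (by positivity), ENNReal.ofReal_mul (by positivity),
        ENNReal.ofReal_mul (by positivity), ENNReal.ofReal_mul (by positivity)]
      simp only [ENNReal.ofReal_toReal (PMF.apply_ne_top _ _), mul_assoc]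
  have hVV : V * V' ≤ (1 - H) * (1 - H') := by
    calc V * V' ≤ |V * V'| := le_abs_self _
      _ = |V| * |V'| := abs_mul _ _
      _ ≤ _ := mul_le_mul hVH hVH' (abs_nonneg _) ((abs_nonneg _).trans hVH)
  calc (2 : ℝ≥0∞) = ENNReal.ofReal 2 := by simp
    _ ≤ ENNReal.ofReal (2 * (w + v) + 2 * (H * H' - V * V')) :=
        ENNReal.ofReal_le_ofReal (by nlinarith)
    _ ≤ ENNReal.ofReal (2 * (w + v)) + ENNReal.ofReal (2 * (H * H' - V * V')) :=
        ENNReal.ofReal_add_le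
    _ ≤ _ := by
        refine add_le_add (le_of_eq ?_) hrisk
        rw [ENNReal.ofReal_mul zero_le_two, ENNReal.ofReal_add (by positivity) (by positivity)]
        simp

/-! ### The advantage -/

theorem successProb_bind_uniform {Ω : Type} (K : ℤˣ → PMF Ω) (f : Ω → ℤˣ) :
    successProb (uniformSpin.bind fun s => (K s).map fun x => (s, x)) f =
      2⁻¹ * (expect (K 1) (fun x => if f x = 1 then 1 else 0) +
        expect (K (-1)) (fun x => if f x = -1 then 1 else 0)) := by
  classical
  have h0 : ∀ (J : PMF (ℤˣ × Ω)), successProb J f = expect J fun x => if f x.2 = x.1 then 1 else 0 := by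
    intro J
    rw [successProb, PMF.toOuterMeasure_apply, expect]
    refine tsum_congr fun x => ?_
    by_cases h : f x.2 = x.1 <;> simp [h, Set.indicator]
  rw [h0, expect_bind]
  simp only [expect_map]
  have : ∀ g : ℤˣ → ℝ≥0∞, expect uniformSpin g = 2⁻¹ * (g 1 + g (-1)) := by
    intro g
    rw [expect, tsum_fintype, UnitsInt.univ]
    simp [uniformSpin, mul_add]
  rw [this]

theorem expect_ite_add_ite {Ω : Type} (p : PMF Ω) (f : Ω → ℤˣ) :
    expect p (fun x => if f x = 1 then 1 else 0) + expect p (fun x => if f x = -1 then 1 else 0)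
      = 1 := by
  rw [← expect_add, ← expect_const p 1]
  congr 1; funext x
  rcases Int.units_eq_one_or (f x) with h | h <;> simp [h]

/-- If `f` succeeds with probability (1 + t)/2, then the estimator t·f has mean squared error 1 -
t², so t² ≤ w. In the notation below, t = a + b - 1. -/
theorem InfoLE.successProb_le {Ω : Type} {K : ℤˣ → PMF Ω} {w : ℝ≥0} (H : InfoLE K w)
    (f : Ω → ℤˣ) :
    successProb (uniformSpin.bind fun s => (K s).map fun x => (s, x)) f ≤
      ENNReal.ofReal ((1 + √w) / 2) := by
  rw [successProb_bind_uniform]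
  have h1 := expect_ite_add_ite (K 1) f
  have h2 := expect_ite_add_ite (K (-1)) f
  set a := expect (K 1) (fun x => if f x = 1 then 1 else 0)
  set a' := expect (K 1) (fun x => if f x = -1 then 1 else 0)
  set b' := expect (K (-1)) (fun x => if f x = 1 then 1 else 0)
  set b := expect (K (-1)) (fun x => if f x = -1 then 1 else 0)
  have ha : a ≠ ∞ := fun h => by simp [h] at h1
  have ha' : a' ≠ ∞ := fun h => by simp [h] at h1
  have hb : b ≠ ∞ := fun h => by simp [h] at h2
  have hb' : b' ≠ ∞ := fun h => by simp [h] at h2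
  have hr : ∀ t : ℝ, quadRisk K (fun x => t * ((f x : ℤ) : ℝ)) =
      ENNReal.ofReal ((1 - t) ^ 2) * (a + b) + ENNReal.ofReal ((1 + t) ^ 2) * (a' + b') := by
    intro t
    have e1 : ∀ x, ENNReal.ofReal ((1 - t * ((f x : ℤ) : ℝ)) ^ 2) =
        ENNReal.ofReal ((1 - t) ^ 2) * (if f x = 1 then 1 else 0)
          + ENNReal.ofReal ((1 + t) ^ 2) * (if f x = -1 then 1 else 0) := fun x => by
      rcases Int.units_eq_one_or (f x) with h | h <;> simp [h]
    have e2 : ∀ x, ENNReal.ofReal ((1 + t * ((f x : ℤ) : ℝ)) ^ 2) =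
        ENNReal.ofReal ((1 + t) ^ 2) * (if f x = 1 then 1 else 0)
          + ENNReal.ofReal ((1 - t) ^ 2) * (if f x = -1 then 1 else 0) := fun x => by
      rcases Int.units_eq_one_or (f x) with h | h <;> simp [h, ← sub_eq_add_neg]
    simp only [quadRisk, e1, e2, expect_add, expect_const_mul]
    simp only [a, a', b, b']
    ring
  clear_value a a' b b'
  lift a to ℝ≥0 using ha
  lift a' to ℝ≥0 using ha'
  lift b to ℝ≥0 using hb
  lift b' to ℝ≥0 using hb'
  have h1' : (a : ℝ) + a' = 1 := by exact_mod_cast h1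
  have h2' : (b' : ℝ) + b = 1 := by exact_mod_cast h2
  have h3 := H fun x => ((a + b - 1 : ℝ)) * ((f x : ℤ) : ℝ)
  rw [hr] at h3
  simp only [← ENNReal.ofReal_coe_nnreal] at h3 ⊢
  rw [show (2 : ℝ≥0∞) = ENNReal.ofReal 2 by simp, ← ENNReal.ofReal_add (by simp) (by simp),
    ← ENNReal.ofReal_add (by simp) (by simp), ← ENNReal.ofReal_mul (by positivity),
    ← ENNReal.ofReal_mul (by positivity), ← ENNReal.ofReal_mul (by positivity),
    ← ENNReal.ofReal_add (by positivity) (by positivity),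
    ← ENNReal.ofReal_add (by positivity) (by positivity),
    ENNReal.ofReal_le_ofReal_iff (by positivity)] at h3
  have h4 : ((a : ℝ) + b - 1) ^ 2 ≤ w := by
    have e1 : (a' : ℝ) = 1 - a := by linarith
    have e2 : (b' : ℝ) = 1 - b := by linarith
    rw [e1, e2] at h3
    nlinarith
  have h5 := Real.le_sqrt_of_sq_le h4
  rw [← ENNReal.ofReal_add (by simp) (by simp),
    show (2⁻¹ : ℝ≥0∞) = ENNReal.ofReal (2⁻¹) by
      rw [ENNReal.ofReal_inv_of_pos (by norm_num)]; simp,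
    ← ENNReal.ofReal_mul (by positivity)]
  exact ENNReal.ofReal_le_ofReal (by linarith)

theorem InfoLE.advantage_le {Ω : Type} {K : ℤˣ → PMF Ω} {w : ℝ≥0} (H : InfoLE K w) :
    advantage (uniformSpin.bind fun s => (K s).map fun x => (s, x)) ≤ √w := by
  have h := ENNReal.toReal_mono ENNReal.ofReal_ne_top (iSup_le H.successProb_le)
  rw [ENNReal.toReal_ofReal (by positivity)] at h
  rw [advantage]
  linarith

theorem advantage_nonneg {Ω : Type} (K : ℤˣ → PMF Ω) :
    0 ≤ advantage (uniformSpin.bind fun s => (K s).map fun x => (s, x)) := by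
  have h1 : (2⁻¹ : ℝ≥0∞) ≤ ⨆ f : Ω → ℤˣ,
      successProb (uniformSpin.bind fun s => (K s).map fun x => (s, x)) f := by
    refine le_trans ?_ (le_iSup _ fun _ => 1)
    rw [successProb_bind_uniform]
    simp
  have h2 : (⨆ f : Ω → ℤˣ,
      successProb (uniformSpin.bind fun s => (K s).map fun x => (s, x)) f) ≠ ∞ := by
    refine ne_top_of_le_ne_top ENNReal.ofReal_ne_top
      (iSup_le (InfoLE.successProb_le (w := 1) (infoLE_of_one_le K (by simp))))
  have h3 := ENNReal.toReal_mono h2 h1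
  rw [advantage]
  simp only [ENNReal.toReal_inv, ENNReal.toReal_ofNat] at h3
  linarith

/-! ### A second moment criterion for recovery -/

/-- The statistic `f` has mean `m` and variance `V` under `p`. -/
def HasMeanVar {α : Type} (p : PMF α) (f : α → ℝ) (m V : ℝ) : Prop :=
  ∀ c : ℝ, expect p (fun x => ENNReal.ofReal ((f x + c) ^ 2)) = ENNReal.ofReal ((m + c) ^ 2 + V)

/-- The likelihood test is optimal, and its success probability is governed by the total variation
distance. A statistic whose means ±m are separated on the scale of its standard deviation forces
that distance to be large. This is Cauchy–Schwarz, carried out pointwise as a weighted AM–GM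
inequality. -/
theorem exists_successProb_ge {Ω : Type} {K : ℤˣ → PMF Ω} {S : Ω → ℝ} {m V C : ℝ} (hm : 0 < m)
    (hC : 0 ≤ C) (hV : 0 ≤ V) (hVC : V ≤ C * m ^ 2) (h1 : HasMeanVar (K 1) S m V)
    (h2 : HasMeanVar (K (-1)) S (-m) V) :
    ∃ f : Ω → ℤˣ, ENNReal.ofReal (1 / 2 + 1 / (2 * (1 + C))) ≤
      successProb (uniformSpin.bind fun s => (K s).map fun x => (s, x)) f := by
  classical
  let f : Ω → ℤˣ := fun x => if K (-1) x ≤ K 1 x then 1 else -1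
  refine ⟨f, ?_⟩
  rw [successProb_bind_uniform]
  -- Chosen so that β(m² + V) ≤ 2m², half of the main term 4m². With D = 4m²/β the inequality 4my ≤
  -- βy² + D is the sharp AM–GM.
  set β : ℝ := 2 / (1 + C) with hβ
  have hβ0 : 0 < β := by positivity
  set A : ℝ≥0∞ := expect (K 1) (fun x => if f x = 1 then 1 else 0) +
        expect (K (-1)) (fun x => if f x = -1 then 1 else 0) with hA
  have hAtop : A ≠ ∞ := by
    have e1 := expect_ite_add_ite (K 1) f
    have e2 := expect_ite_add_ite (K (-1)) f
    have : A ≤ 1 + 1 := add_le_add (le_self_add.trans e1.le) (le_add_self.trans e2.le)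
    exact ne_top_of_le_ne_top (by simp) this
  set D : ℝ := 4 * m ^ 2 / β with hD
  have hD0 : 0 < D := by positivity
  -- Pointwise this is 4mS(p - q) ≤ βS²(p + q) + D|p - q|, with |p - q| written as 2 max(p, q) - (p
  -- + q). Every term is moved to the side where it is nonnegative, so that both sides can be summed
  -- in `ℝ≥0∞`.
  have key : expect (K 1) (fun x => ENNReal.ofReal ((S x + m) ^ 2))
      + expect (K (-1)) (fun x => ENNReal.ofReal ((S x + -m) ^ 2)) + 2 * ENNReal.ofReal D ≤
      (expect (K (-1)) (fun x => ENNReal.ofReal ((S x + m) ^ 2))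
      + expect (K 1) (fun x => ENNReal.ofReal ((S x + -m) ^ 2)))
      + (ENNReal.ofReal β * (expect (K 1) (fun x => ENNReal.ofReal ((S x + 0) ^ 2))
        + expect (K (-1)) (fun x => ENNReal.ofReal ((S x + 0) ^ 2)))
        + 2 * (ENNReal.ofReal D * A)) := by
    have c1 : ENNReal.ofReal D = ∑' x, K 1 x * ENNReal.ofReal D := (expect_const (K 1) _).symm
    have c2 : ENNReal.ofReal D = ∑' x, K (-1) x * ENNReal.ofReal D := (expect_const (K (-1)) _).symm
    rw [two_mul (ENNReal.ofReal D)]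
    conv_lhs => rw [c1]
    conv_lhs => enter [2, 2]; rw [← c1, c2]
    simp only [hA, expect, ← ENNReal.tsum_mul_left, ← ENNReal.tsum_add]
    refine ENNReal.tsum_le_tsum fun x => ?_
    have pe := ENNReal.ofReal_toReal ((K 1).apply_ne_top x)
    have qe := ENNReal.ofReal_toReal ((K (-1)).apply_ne_top x)
    have hfx : f x = if (K (-1) x).toReal ≤ (K 1 x).toReal then 1 else -1 := by
      simp only [f, ENNReal.toReal_le_toReal ((K (-1)).apply_ne_top x) ((K 1).apply_ne_top x)]
    set p := (K 1 x).toReal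
    set q := (K (-1) x).toReal
    have hp : 0 ≤ p := ENNReal.toReal_nonneg
    have hq : 0 ≤ q := ENNReal.toReal_nonneg
    have hmax : K 1 x * (if f x = 1 then 1 else 0) + K (-1) x * (if f x = -1 then 1 else 0)
        = ENNReal.ofReal (max p q) := by
      rw [hfx]
      by_cases h : q ≤ p <;> simp only [h, if_true, if_false]
      · rw [max_eq_left h, pe]; simp
      · rw [max_eq_right (le_of_not_ge h), qe]; simp
    rw [hmax, ← pe, ← qe]
    have hp2 : 0 ≤ max p q := le_max_of_le_left hp
    rw [show (2 : ℝ≥0∞) = ENNReal.ofReal 2 by simp]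
    simp only [← ENNReal.ofReal_mul hp, ← ENNReal.ofReal_mul hq, ← ENNReal.ofReal_mul hD0.le]
    rw [← ENNReal.ofReal_mul zero_le_two]
    rw [← ENNReal.ofReal_add (by positivity) (by positivity),
      ← ENNReal.ofReal_add (by positivity) (by positivity),
      ← ENNReal.ofReal_add (by positivity) (by positivity),
      ← ENNReal.ofReal_add (by positivity) (by positivity),
      ← ENNReal.ofReal_add (by positivity) (by positivity),
      ← ENNReal.ofReal_mul hβ0.le,
      ← ENNReal.ofReal_add (by positivity) (by positivity),
      ← ENNReal.ofReal_add (by positivity) (by positivity)]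
    refine ENNReal.ofReal_le_ofReal ?_
    have hDm : D * β = 4 * m ^ 2 := by rw [hD]; field_simp
    have amgm : ∀ y : ℝ, 4 * m * y ≤ β * y ^ 2 + D := fun y => by
      refine le_of_mul_le_mul_left ?_ hβ0
      nlinarith [sq_nonneg (β * y - 2 * m)]
    have a1 := amgm (S x)
    have a2 := amgm (-S x)
    rcases le_total q p with h | h
    · rw [max_eq_left h]
      nlinarith [mul_nonneg (sub_nonneg.2 h) (sub_nonneg.2 a1),
        mul_nonneg hq (mul_nonneg hβ0.le (sq_nonneg (S x)))]
    · rw [max_eq_right h]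
      nlinarith [mul_nonneg (sub_nonneg.2 h) (sub_nonneg.2 a2),
        mul_nonneg hp (mul_nonneg hβ0.le (sq_nonneg (S x)))]
  rw [h1, h1, h1, h2, h2, h2] at key
  clear_value A
  lift A to ℝ≥0 using hAtop
  simp only [← ENNReal.ofReal_coe_nnreal] at key ⊢
  rw [show (2 : ℝ≥0∞) = ENNReal.ofReal 2 by simp] at key
  rw [← ENNReal.ofReal_mul zero_le_two, ← ENNReal.ofReal_mul hD0.le, ← ENNReal.ofReal_mul zero_le_two,
    ← ENNReal.ofReal_add (by positivity) (by positivity),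
    ← ENNReal.ofReal_add (by positivity) (by positivity),
    ← ENNReal.ofReal_add (by positivity) (by positivity),
    ← ENNReal.ofReal_add (by positivity) (by positivity),
    ← ENNReal.ofReal_mul hβ0.le,
    ← ENNReal.ofReal_add (by positivity) (by positivity),
    ← ENNReal.ofReal_add (by positivity) (by positivity),
    ENNReal.ofReal_le_ofReal_iff (by positivity)] at key
  have hm2 : 0 < m ^ 2 := by positivity
  have hDm : D * β = 4 * m ^ 2 := by rw [hD]; field_simp
  have hβC : β * (1 + C) = 2 := by rw [hβ]; field_simp
  have k1 : β * (m ^ 2 + V) ≤ 2 * m ^ 2 := by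
    calc β * (m ^ 2 + V) ≤ β * (m ^ 2 + C * m ^ 2) := by gcongr
      _ = β * (1 + C) * m ^ 2 := by ring
      _ = _ := by rw [hβC]
  have k2 : 4 * m ^ 2 + 2 * D ≤ 2 * (D * A) := by nlinarith
  have k3 : 1 + β / 2 ≤ (A : ℝ) := by
    refine le_of_mul_le_mul_left ?_ hD0
    nlinarith
  rw [show (2⁻¹ : ℝ≥0∞) = ENNReal.ofReal (2⁻¹) by
      rw [ENNReal.ofReal_inv_of_pos (by norm_num)]; simp,
    ← ENNReal.ofReal_mul (by positivity)]
  refine ENNReal.ofReal_le_ofReal ?_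
  have : 1 / (2 * (1 + C)) = β / 4 := by rw [hβ]; field_simp; norm_num
  rw [this]
  linarith

/-! ### Constructors of labelled trees -/

/-- The tree of height `0` with label `x`. -/
def LTree.leaf {α : Type} (x : α) : LTree α 0 := x

/-- The tree with root label `x` and the subtrees `m`. -/
def LTree.node {α : Type} {n : ℕ} (x : α) (m : Multiset (LTree α n)) : LTree α (n + 1) := (x, m)

theorem broadcastTree_zero {β : Type} (a b : ℝ≥0) (μ : PMF β) (s : ℤˣ) :
    broadcastTree a b μ 0 s = μ.map fun c => LTree.leaf (s, c) := rfl

theorem broadcastTree_succ {β : Type} (a b : ℝ≥0) (μ : PMF β) (n : ℕ) (s : ℤˣ) :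
    broadcastTree a b μ (n + 1) s =
      μ.bind fun c =>
      (poisson (a / 2)).bind fun i =>
      (poisson (b / 2)).bind fun j =>
      (iidMultiset (broadcastTree a b μ n s) i).bind fun same =>
      (iidMultiset (broadcastTree a b μ n (-s)) j).map fun opp =>
        LTree.node (s, c) (same + opp) := rfl

@[simp]
theorem leafView_leaf {β : Type} (s : ℤˣ) (c : β) :
    leafView (LTree.leaf (s, c)) = LTree.leaf (some s) := rfl

@[simp]
theorem leafView_node {β : Type} {n : ℕ} (x : ℤˣ × β) (m : Multiset (LTree (ℤˣ × β) n)) :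
    leafView (LTree.node x m) = LTree.node none (m.map leafView) := rfl

/-! ### Poisson distributions -/

theorem poisson_apply (c : ℝ≥0) (n : ℕ) :
    poisson c n = ENNReal.ofReal (Real.exp (-c) * c ^ n / n.factorial) := by
  rw [poisson, MeasureTheory.Measure.toPMF_apply, ProbabilityTheory.poissonMeasure_singleton]

/-- The factor n cancels against n!, which shifts the index by one. The value of `p (n - 1)` at n =
0 is multiplied by zero. -/
theorem hasSum_poisson_mul_self (c : ℝ) {p : ℕ → ℝ} {a : ℝ}
    (h : HasSum (fun n => Real.exp (-c) * c ^ n / n.factorial * p n) a) :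
    HasSum (fun n : ℕ => Real.exp (-c) * c ^ n / n.factorial * (n * p (n - 1))) (c * a) := by
  rw [← hasSum_nat_add_iff' 1]
  simp only [Finset.sum_range_one, Nat.cast_zero, zero_mul, mul_zero, sub_zero]
  refine (h.mul_left c).congr_fun fun n => ?_
  simp only [Nat.factorial_succ, Nat.cast_mul, Nat.add_sub_cancel]
  field_simp
  ring

theorem expect_poisson_eq {c : ℝ≥0} {f : ℕ → ℝ} {a : ℝ} (hf : ∀ n, 0 ≤ f n)
    (h : HasSum (fun n => Real.exp (-c) * c ^ n / n.factorial * f n) a) :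
    expect (poisson c) (fun n => ENNReal.ofReal (f n)) = ENNReal.ofReal a := by
  rw [expect, ← h.tsum_eq, ENNReal.ofReal_tsum_of_nonneg _ h.summable]
  · refine tsum_congr fun n => ?_
    rw [poisson_apply, ENNReal.ofReal_mul (by positivity)]
  · intro n
    have := hf n
    positivity

theorem hasSum_poisson_one (c : ℝ≥0) :
    HasSum (fun n => Real.exp (-c) * c ^ n / n.factorial * 1) 1 := by
  simpa using ProbabilityTheory.hasSum_one_poissonMeasure c

theorem hasSum_poisson_id (c : ℝ≥0) :
    HasSum (fun n : ℕ => Real.exp (-c) * c ^ n / n.factorial * n) c := by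
  simpa using hasSum_poisson_mul_self c (p := fun _ => 1) (hasSum_poisson_one c)

theorem hasSum_poisson_sq (c : ℝ≥0) :
    HasSum (fun n : ℕ => Real.exp (-c) * c ^ n / n.factorial * (n : ℝ) ^ 2) (c ^ 2 + c) := by
  have h := hasSum_poisson_mul_self c (p := fun n => n) (hasSum_poisson_id c)
  have h' := h.add (hasSum_poisson_id c)
  rw [sq]
  refine h'.congr_fun fun n => ?_
  rcases n with _ | n
  · simp
  · simp only [Nat.add_sub_cancel, Nat.cast_add, Nat.cast_one]; ring

theorem expect_poisson_id (c : ℝ≥0) : expect (poisson c) (fun n => (n : ℝ≥0∞)) = c := by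
  have := expect_poisson_eq (fun n => Nat.cast_nonneg n) (hasSum_poisson_id c)
  simpa using this

/-- The second moment of a compound Poisson sum: the fluctuation of the number of summands adds κm²
to the variance. The parameters `c` and `d` absorb the mean and variance of an independent
remainder, so that the children of either spin can be averaged out in turn. -/
theorem expect_poisson_compound (κ : ℝ≥0) (m V c d : ℝ) (hV : 0 ≤ V) (hd : 0 ≤ d) :
    expect (poisson κ) (fun j => ENNReal.ofReal ((j * m + c) ^ 2 + (j * V + d))) =
      ENNReal.ofReal ((κ * m + c) ^ 2 + (κ * (V + m ^ 2) + d)) := by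
  refine expect_poisson_eq (fun n => by positivity) ?_
  have h := ((hasSum_poisson_sq κ).mul_left (m ^ 2)).add
    (((hasSum_poisson_id κ).mul_left (2 * m * c + V)).add
      ((hasSum_poisson_one κ).mul_left (c ^ 2 + d)))
  have e : m ^ 2 * ((κ : ℝ) ^ 2 + κ) + ((2 * m * c + V) * κ + (c ^ 2 + d) * 1) =
      (κ * m + c) ^ 2 + (κ * (V + m ^ 2) + d) := by ring
  rw [e] at h
  exact h.congr_fun fun n => by ring

/-! ### Moments of the sum of the leaf spins -/

theorem HasMeanVar.add {α β : Type} {p : PMF α} {q : PMF β} {f : α → ℝ} {g : β → ℝ}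
    {m m' V V' : ℝ} (hf : HasMeanVar p f m V) (hg : HasMeanVar q g m' V') (hV : 0 ≤ V)
    (hV' : 0 ≤ V') (c : ℝ) :
    (expect p fun x => expect q fun y => ENNReal.ofReal ((f x + g y + c) ^ 2)) =
      ENNReal.ofReal ((m + m' + c) ^ 2 + (V + V')) := by
  have h1 : ∀ x, (expect q fun y => ENNReal.ofReal ((f x + g y + c) ^ 2)) =
      ENNReal.ofReal ((f x + (m' + c)) ^ 2) + ENNReal.ofReal V' := fun x => by
    rw [← ENNReal.ofReal_add (by positivity) hV', show f x + (m' + c) = m' + (f x + c) by ring,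
      ← hg]
    congr 1; funext y; congr 1; ring
  simp only [h1, expect_add, expect_const]
  rw [hf, ← ENNReal.ofReal_add (by positivity) hV']
  congr 1; ring

theorem HasMeanVar.iidMultiset {α : Type} {p : PMF α} {f : α → ℝ} {m V : ℝ}
    (h : HasMeanVar p f m V) (hV : 0 ≤ V) (i : ℕ) :
    HasMeanVar (iidMultiset p i) (fun s => (s.map f).sum) (i * m) (i * V) := by
  induction i with
  | zero => intro c; simp [_root_.iidMultiset]
  | succ i ih =>
    intro c
    rw [_root_.iidMultiset, expect_bind]
    simp only [expect_map, Multiset.map_cons, Multiset.sum_cons]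
    rw [h.add ih hV (by positivity)]
    congr 1; push_cast; ring

/-- The sum of the spins of the leaves. -/
def leafSum : {n : ℕ} → LTree (Option ℤˣ) n → ℝ
  | 0, t => Option.elim (α := ℤˣ) t 0 fun s => ((s : ℤ) : ℝ)
  | _ + 1, t => (t.2.map leafSum).sum

@[simp]
theorem leafSum_leaf (s : ℤˣ) : leafSum (LTree.leaf (some s)) = ((s : ℤ) : ℝ) := rfl

@[simp]
theorem leafSum_node {n : ℕ} (x : Option ℤˣ) (m : Multiset (LTree (Option ℤˣ) n)) :
    leafSum (LTree.node x m) = (m.map leafSum).sum := rfl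

/-- The variance of the sum of the leaf spins, for a root of given spin. -/
def leafVar (κ l : ℝ) : ℕ → ℝ
  | 0 => 0
  | n + 1 => κ * (leafVar κ l n + (l ^ n) ^ 2)

theorem leafVar_nonneg {κ l : ℝ} (hκ : 0 ≤ κ) (n : ℕ) : 0 ≤ leafVar κ l n := by
  induction n with
  | zero => exact le_rfl
  | succ n ih => rw [leafVar]; positivity

/-- The constant C = κ/(l² - κ) is the solution of κ(C + 1) = C·l², so the recursion preserves the
bound. -/
theorem leafVar_le {κ l : ℝ} (hκ : 0 ≤ κ) (hl : κ < l ^ 2) (n : ℕ) :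
    leafVar κ l n ≤ κ / (l ^ 2 - κ) * (l ^ n) ^ 2 := by
  have h0 : 0 < l ^ 2 - κ := sub_pos.2 hl
  induction n with
  | zero => simp only [leafVar]; positivity
  | succ n ih =>
    rw [leafVar]
    calc κ * (leafVar κ l n + (l ^ n) ^ 2)
        ≤ κ * (κ / (l ^ 2 - κ) * (l ^ n) ^ 2 + (l ^ n) ^ 2) := by gcongr
      _ = _ := by field_simp; ring

theorem hasMeanVar_leafSum {β : Type} (a b : ℝ≥0) (μ : PMF β) (n : ℕ) (s : ℤˣ) :
    HasMeanVar (broadcastTree a b μ n s) (fun t => leafSum (leafView t))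
      (((s : ℤ) : ℝ) * (((a : ℝ) - b) / 2) ^ n)
      (leafVar (((a : ℝ) + b) / 2) (((a : ℝ) - b) / 2) n) := by
  induction n generalizing s with
  | zero =>
    intro c
    rw [broadcastTree_zero, expect_map]
    simp [leafVar]
  | succ n ih =>
    intro c
    have hV := leafVar_nonneg (l := ((a : ℝ) - b) / 2) (by positivity : 0 ≤ ((a : ℝ) + b) / 2) n
    have hs : ((s : ℤ) : ℝ) ^ 2 = 1 := by
      rcases Int.units_eq_one_or s with h | h <;> simp [h]
    rw [broadcastTree_succ]
    simp only [expect_bind, expect_map, leafView_node, leafSum_node, Multiset.map_map, Function.comp_def,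
      Multiset.map_add, Multiset.sum_add]
    simp only [((ih s).iidMultiset hV _).add ((ih (-s)).iidMultiset hV _) (by positivity)
      (by positivity)]
    set V := leafVar (((a : ℝ) + b) / 2) (((a : ℝ) - b) / 2) n
    set l := ((a : ℝ) - b) / 2 with hl
    have e1 : ∀ i : ℕ, (expect (poisson (b / 2)) fun j => ENNReal.ofReal
        ((i * (((s : ℤ) : ℝ) * l ^ n) + j * ((((-s : ℤˣ) : ℤ) : ℝ) * l ^ n) + c) ^ 2
          + (i * V + j * V))) =
        ENNReal.ofReal ((i * (((s : ℤ) : ℝ) * l ^ n)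
          + ((b / 2 : ℝ≥0) * (-((s : ℤ) : ℝ) * l ^ n) + c)) ^ 2
          + (i * V + (b / 2 : ℝ≥0) * (V + (l ^ n) ^ 2))) := fun i => by
      have := expect_poisson_compound (b / 2) (-((s : ℤ) : ℝ) * l ^ n) V
        (i * (((s : ℤ) : ℝ) * l ^ n) + c) (i * V) hV (by positivity)
      refine Eq.trans ?_ (this.trans ?_)
      · congr 1; funext j; congr 1; push_cast; ring
      · congr 1
        rw [mul_pow, neg_sq, hs]; ring
    simp only [e1]
    rw [expect_poisson_compound (a / 2) _ V _ _ hV (by positivity), expect_const, mul_pow, hs,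
      leafVar]
    congr 1
    push_cast
    simp only [hl]; ring

/-- Above the Kesten–Stigum threshold, partial recovery is possible in the random model. -/
theorem exists_randomModel_estimator {a b : ℝ≥0} (hab : b < a)
    (h : ((a : ℝ) + b) / 2 < (((a : ℝ) - b) / 2) ^ 2) :
    ∃ f : (R : ℕ) → LTree (Option ℤˣ) R → ℤˣ, ∃ η : ℝ, 1 / 2 < η ∧
      ∀ R, ENNReal.ofReal η ≤ successProb (randomModel a b R) (f R) := by
  set κ := ((a : ℝ) + b) / 2 with hκ
  set l := ((a : ℝ) - b) / 2 with hl
  have hκ0 : 0 ≤ κ := by positivity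
  have hl0 : 0 < l := by
    have : (b : ℝ) < a := hab
    rw [hl]; linarith
  have hC : 0 ≤ κ / (l ^ 2 - κ) := div_nonneg hκ0 (sub_pos.2 h).le
  have H : ∀ R, ∃ f : LTree (Option ℤˣ) R → ℤˣ,
      ENNReal.ofReal (1 / 2 + 1 / (2 * (1 + κ / (l ^ 2 - κ)))) ≤
        successProb (randomModel a b R) f := by
    intro R
    have hMV : ∀ s : ℤˣ, HasMeanVar ((broadcastTree a b (PMF.pure ()) R s).map leafView) leafSum
        (((s : ℤ) : ℝ) * l ^ R) (leafVar κ l R) := fun s c => by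
      rw [expect_map]; exact hasMeanVar_leafSum a b (PMF.pure ()) R s c
    have := exists_successProb_ge
      (K := fun s => (broadcastTree a b (PMF.pure ()) R s).map leafView)
      (pow_pos hl0 R) hC (leafVar_nonneg hκ0 R) (leafVar_le hκ0 h R)
      (by simpa using hMV 1) (by simpa using hMV (-1))
    simpa only [randomModel, PMF.map_comp, Function.comp_def] using this
  choose f hf using H
  exact ⟨f, _, by have : 0 < 1 / (2 * (1 + κ / (l ^ 2 - κ))) := by positivity
                  linarith, hf⟩

/-! ### Galton–Watson topologies -/

/-- Rooted ordered trees of height at most `n`. -/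
def Topo : ℕ → Type
  | 0 => Unit
  | n + 1 => List (Topo n)

/-- The tree with the subtrees `l`. -/
def Topo.node {n : ℕ} (l : List (Topo n)) : Topo (n + 1) := l

/-- The subtrees hanging from the children of the root. -/
def Topo.children {n : ℕ} (t : Topo (n + 1)) : List (Topo n) := t

theorem Topo.exists_eq_node {n : ℕ} (t : Topo (n + 1)) : ∃ l, t = Topo.node l := ⟨t, rfl⟩

@[simp]
theorem Topo.children_node {n : ℕ} (l : List (Topo n)) : (Topo.node l).children = l := rfl

/-- A list of independent samples from `p`. -/
def iidList {α : Type} (p : PMF α) : ℕ → PMF (List α)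
  | 0 => PMF.pure []
  | m + 1 => p.bind fun x => (iidList p m).map fun l => x :: l

/-- The Galton–Watson tree with offspring distribution `Pois(κ)`, grown until depth `n`. -/
def galtonWatson (κ : ℝ≥0) : (n : ℕ) → PMF (Topo n)
  | 0 => PMF.pure ()
  | n + 1 => (poisson κ).bind fun d => (iidList (galtonWatson κ n) d).map Topo.node

theorem expect_galtonWatson_succ (κ : ℝ≥0) (n : ℕ) (g : Topo (n + 1) → ℝ≥0∞) :
    expect (galtonWatson κ (n + 1)) g =
      expect (poisson κ) fun d => expect (iidList (galtonWatson κ n) d) fun l =>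
        g (Topo.node l) := by
  simp only [galtonWatson, expect_bind, expect_map]

/-- The multiset of independent samples, one from `Q a` for each member `a` of the list. -/
def indepMultiset {α β : Type} (Q : α → PMF β) : List α → PMF (Multiset β)
  | [] => PMF.pure 0
  | a :: l => (Q a).bind fun x => (indepMultiset Q l).map fun s => x ::ₘ s

/-- All hidden parameters can be drawn first and the samples afterwards. This pulls the topology out
of the broadcast process. -/
theorem iidMultiset_bind {α β : Type} (p : PMF α) (Q : α → PMF β) (d : ℕ) :
    iidMultiset (p.bind Q) d = (iidList p d).bind (indepMultiset Q) := by
  induction d with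
  | zero => simp [iidMultiset, iidList, indepMultiset]
  | succ d ih =>
    refine pmf_ext_expect fun g => ?_
    simp only [iidMultiset, iidList, ih, expect_bind, expect_map, indepMultiset]
    congr 1; funext a
    exact expect_comm _ _ _

/-- The spin of a child: that of its parent with probability `p`. -/
def noisySpin {p q : ℝ≥0} (h : p + q = 1) (s : ℤˣ) : PMF ℤˣ :=
  twoPoint p q (by exact_mod_cast h) s (-s)

theorem expect_noisySpin {p q : ℝ≥0} (h : p + q = 1) (s : ℤˣ) (g : ℤˣ → ℝ≥0∞) :
    expect (noisySpin h s) g = p * g s + q * g (-s) :=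
  expect_twoPoint _ _ _ _

/-- The broadcast process on a given topology. -/
def spinLaw {β : Type} {p q : ℝ≥0} (h : p + q = 1) (μ : PMF β) :
    (n : ℕ) → Topo n → ℤˣ → PMF (LTree (ℤˣ × β) n)
  | 0, _, s => μ.map fun c => LTree.leaf (s, c)
  | n + 1, t, s => μ.bind fun c =>
      (indepMultiset (fun t' => (noisySpin h s).bind fun s' => spinLaw h μ n t' s')
        t.children).map fun m => LTree.node (s, c) m

theorem spinLaw_zero {β : Type} {p q : ℝ≥0} (h : p + q = 1) (μ : PMF β) (t : Topo 0) (s : ℤˣ) :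
    spinLaw h μ 0 t s = μ.map fun c => LTree.leaf (s, c) := rfl

theorem spinLaw_node {β : Type} {p q : ℝ≥0} (h : p + q = 1) (μ : PMF β) (n : ℕ)
    (l : List (Topo n)) (s : ℤˣ) :
    spinLaw h μ (n + 1) (Topo.node l) s = μ.bind fun c =>
      (indepMultiset (fun t' => (noisySpin h s).bind fun s' => spinLaw h μ n t' s') l).map fun m =>
        LTree.node (s, c) m := rfl

/-- Binomial expansion of independent samples from a mixture. -/
theorem expect_iidMultiset_mixture {α : Type} {M P Q : PMF α} {p q : ℝ≥0∞}
    (hM : ∀ g, expect M g = p * expect P g + q * expect Q g) (d : ℕ) (g : Multiset α → ℝ≥0∞) :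
    expect (iidMultiset M d) g = ∑ ij ∈ Finset.HasAntidiagonal.antidiagonal d,
      (d.choose ij.1 : ℝ≥0∞) *
      (p ^ ij.1 * q ^ ij.2 * expect (iidMultiset P ij.1) fun x =>
        expect (iidMultiset Q ij.2) fun y => g (x + y)) := by
  induction d generalizing g with
  | zero => simp [iidMultiset]
  | succ d ih =>
    rw [Finset.sum_antidiagonal_choose_succ_mul (fun i j => p ^ i * q ^ j *
      expect (iidMultiset P i) fun x => expect (iidMultiset Q j) fun y => g (x + y)) d]
    rw [iidMultiset, expect_bind]
    simp only [expect_map, ih]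
    rw [hM, add_comm]
    simp only [expect_sum, Finset.mul_sum]
    congr 1
    · refine Finset.sum_congr rfl fun ij _ => ?_
      simp only [expect_const_mul, iidMultiset, expect_bind, expect_map, Multiset.add_cons]
      rw [expect_comm]
      ring
    · refine Finset.sum_congr rfl fun ij hij => ?_
      rw [Finset.HasAntidiagonal.mem_antidiagonal] at hij
      simp only [expect_const_mul, iidMultiset, expect_bind, expect_map, Multiset.cons_add]
      rw [Nat.choose_symm_of_eq_add hij.symm]
      ring

theorem poisson_add_mul_choose (κ p q : ℝ≥0) (h : p + q = 1) (i j : ℕ) :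
    poisson κ (i + j) * (((i + j).choose i : ℝ≥0∞) * ((p : ℝ≥0∞) ^ i * (q : ℝ≥0∞) ^ j)) =
      poisson (κ * p) i * poisson (κ * q) j := by
  simp only [poisson_apply]
  rw [← ENNReal.ofReal_mul (by positivity), ← ENNReal.ofReal_coe_nnreal (p := p),
    ← ENNReal.ofReal_coe_nnreal (p := q), ← ENNReal.ofReal_pow (by positivity),
    ← ENNReal.ofReal_pow (by positivity), ← ENNReal.ofReal_natCast,
    ← ENNReal.ofReal_mul (by positivity), ← ENNReal.ofReal_mul (by positivity),
    ← ENNReal.ofReal_mul (by positivity)]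
  congr 1
  have hf : (((i + j).choose i : ℕ) : ℝ) * i.factorial * j.factorial = (i + j).factorial := by
    have := Nat.add_choose_mul_factorial_mul_factorial i j
    rw [← Nat.choose_symm_add] at this
    exact_mod_cast this
  have hpq : (p : ℝ) + q = 1 := by exact_mod_cast h
  have he : Real.exp (-(κ : ℝ)) = Real.exp (-((κ * p : ℝ≥0) : ℝ)) * Real.exp (-((κ * q : ℝ≥0) : ℝ)) := by
    rw [← Real.exp_add]; congr 1; push_cast; linear_combination (κ : ℝ) * hpq
  have h0 : (((i + j).choose i : ℕ) : ℝ) ≠ 0 :=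
    Nat.cast_ne_zero.2 (Nat.choose_pos (Nat.le_add_right i j)).ne'
  rw [he, ← hf]
  push_cast
  field_simp
  ring

/-- Poisson thinning. -/
theorem expect_poisson_iidMultiset_mixture {α : Type} {M P Q : PMF α} (κ p q : ℝ≥0)
    (h : p + q = 1) (hM : ∀ g, expect M g = p * expect P g + q * expect Q g)
    (g : Multiset α → ℝ≥0∞) :
    (expect (poisson κ) fun d => expect (iidMultiset M d) g) =
      expect (poisson (κ * p)) fun i => expect (poisson (κ * q)) fun j =>
        expect (iidMultiset P i) fun x => expect (iidMultiset Q j) fun y => g (x + y) := by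
  simp only [expect_iidMultiset_mixture hM]
  set F : ℕ → ℕ → ℝ≥0∞ := fun i j =>
    expect (iidMultiset P i) fun x => expect (iidMultiset Q j) fun y => g (x + y)
  have e : ∀ d, poisson κ d * ∑ ij ∈ Finset.HasAntidiagonal.antidiagonal d,
      (d.choose ij.1 : ℝ≥0∞) *
      ((p : ℝ≥0∞) ^ ij.1 * (q : ℝ≥0∞) ^ ij.2 * F ij.1 ij.2) =
      ∑ ij ∈ Finset.HasAntidiagonal.antidiagonal d,
      poisson (κ * p) ij.1 * (poisson (κ * q) ij.2 * F ij.1 ij.2) := by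
    intro d
    rw [Finset.mul_sum]
    refine Finset.sum_congr rfl fun ij hij => ?_
    rw [Finset.HasAntidiagonal.mem_antidiagonal] at hij
    rw [← mul_assoc (poisson (κ * p) _), ← poisson_add_mul_choose κ p q h, hij]
    ring
  change ∑' d, poisson κ d * ∑ ij ∈ Finset.HasAntidiagonal.antidiagonal d,
      (d.choose ij.1 : ℝ≥0∞) *
      ((p : ℝ≥0∞) ^ ij.1 * (q : ℝ≥0∞) ^ ij.2 * F ij.1 ij.2) =
    ∑' i, poisson (κ * p) i * ∑' j, poisson (κ * q) j * F i j
  simp only [e, ← ENNReal.tsum_mul_left]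
  rw [← ENNReal.tsum_prod (f := fun i j => poisson (κ * p) i * (poisson (κ * q) j * F i j)),
    ← Finset.HasAntidiagonal.sigmaAntidiagonalEquivProd.tsum_eq, ENNReal.tsum_sigma']
  refine tsum_congr fun d => ?_
  rw [tsum_fintype, ← Finset.sum_attach]
  rfl

/-- By Poisson thinning, splitting `Pois(κ)` children by independent flips gives independent Poisson
numbers of each spin. Given the topology, the markings are deterministic and only spins and coins
remain random. -/
theorem broadcastTree_eq_bind_spinLaw {β : Type} {a b κ p q : ℝ≥0} (h : p + q = 1)
    (ha : a / 2 = κ * p) (hb : b / 2 = κ * q) (μ : PMF β) (n : ℕ) (s : ℤˣ) :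
    broadcastTree a b μ n s = (galtonWatson κ n).bind fun t => spinLaw h μ n t s := by
  induction n generalizing s with
  | zero =>
    simp only [broadcastTree_zero, spinLaw_zero, PMF.bind_const]
  | succ n ih =>
    refine pmf_ext_expect fun g => ?_
    have hmix : ∀ f, expect ((galtonWatson κ n).bind fun t =>
        (noisySpin h s).bind fun s' => spinLaw h μ n t s') f =
        p * expect (broadcastTree a b μ n s) f + q * expect (broadcastTree a b μ n (-s)) f := by
      intro f
      rw [ih, ih, expect_bind, expect_bind, expect_bind, ← expect_const_mul, ← expect_const_mul,
        ← expect_add]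
      congr 1; funext t
      rw [expect_bind, expect_noisySpin]
    rw [expect_bind, expect_galtonWatson_succ]
    simp only [spinLaw_node, expect_bind, expect_map]
    have e : ∀ d, (expect (iidList (galtonWatson κ n) d) fun l => expect μ fun c =>
        expect (indepMultiset (fun t => (noisySpin h s).bind fun s' => spinLaw h μ n t s') l)
          fun m => g (LTree.node (s, c) m)) = expect μ fun c => expect (iidMultiset
            ((galtonWatson κ n).bind fun t => (noisySpin h s).bind fun s' => spinLaw h μ n t s') d)
              fun m => g (LTree.node (s, c) m) := by
      intro d
      rw [expect_comm]
      simp only [iidMultiset_bind, expect_bind]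
    simp only [e]
    rw [expect_comm, broadcastTree_succ, expect_bind]
    congr 1; funext c
    rw [expect_poisson_iidMultiset_mixture κ p q h hmix, ha, hb]
    simp only [expect_bind, expect_map]

/-! ### Expectations over Galton–Watson trees -/

theorem expect_iidList_sum {α : Type} (p : PMF α) (f : α → ℝ≥0∞) (d : ℕ) :
    expect (iidList p d) (fun l => (l.map f).sum) = d * expect p f := by
  induction d with
  | zero => simp [iidList]
  | succ d ih =>
    simp only [iidList, expect_bind, expect_map, List.map_cons, List.sum_cons, expect_add,
      expect_const, ih]
    push_cast; ring

theorem expect_galtonWatson_sum (κ : ℝ≥0) (n : ℕ) (f : Topo n → ℝ≥0∞) :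
    expect (galtonWatson κ (n + 1)) (fun t => (t.children.map f).sum) =
      κ * expect (galtonWatson κ n) f := by
  rw [expect_galtonWatson_succ]
  simp only [Topo.children_node, expect_iidList_sum]
  simp only [mul_comm _ (expect (galtonWatson κ n) f), expect_const_mul, expect_poisson_id]

theorem iidList_apply {α : Type} (p : PMF α) (l : List α) :
    iidList p l.length l = (l.map p).prod := by
  classical
  induction l with
  | nil => simp [iidList]
  | cons a l ih =>
    rw [List.length_cons, iidList, PMF.bind_apply, tsum_eq_single a]
    · rw [PMF.map_apply, tsum_eq_single l]
      · simp [ih]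
      · intro l' h; simp [Ne.symm h]
    · intro b hb
      rw [PMF.map_apply]
      simp [Ne.symm hb]

theorem galtonWatson_node_ge (κ : ℝ≥0) (n : ℕ) (l : List (Topo n)) :
    poisson κ l.length * (l.map (galtonWatson κ n)).prod ≤ galtonWatson κ (n + 1) (Topo.node l) := by
  classical
  rw [galtonWatson, PMF.bind_apply]
  refine le_trans ?_ (ENNReal.le_tsum l.length)
  rw [← iidList_apply, PMF.map_apply]
  gcongr
  refine le_trans ?_ (ENNReal.le_tsum l)
  simp

/-- The tree whose root has three leaf children and a child with a single child, which in turn has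
three leaf children and one more child carrying the subtree `t`. -/
def Topo.gadget {n : ℕ} (t : Topo (n + 1)) : Topo (n + 4) :=
  .node [.node [.node [t, .node [], .node [], .node []]], .node [], .node [], .node []]

theorem Topo.gadget_injective {n : ℕ} : Function.Injective (Topo.gadget (n := n)) := by
  intro t t' h
  have h1 := (List.cons.inj (show Topo.children (Topo.gadget t) = Topo.children (Topo.gadget t')
    from congrArg _ h)).1
  have h2 := (List.cons.inj (congrArg Topo.children h1)).1
  exact (List.cons.inj (congrArg Topo.children h2)).1

/-- A lower bound for the probability of the shape `Topo.gadget`. -/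
def gadgetProb (κ : ℝ≥0) : ℝ≥0∞ := poisson κ 4 ^ 2 * poisson κ 1 * poisson κ 0 ^ 6

theorem galtonWatson_gadget_ge (κ : ℝ≥0) (n : ℕ) (t : Topo (n + 1)) :
    gadgetProb κ * galtonWatson κ (n + 1) t ≤ galtonWatson κ (n + 4) t.gadget := by
  have h0 : ∀ m, poisson κ 0 ≤ galtonWatson κ (m + 1) (Topo.node []) := fun m => by
    simpa using galtonWatson_node_ge κ m []
  have h1 := galtonWatson_node_ge κ (n + 1) [t, .node [], .node [], .node []]
  have h2 := galtonWatson_node_ge κ (n + 2) [.node [t, .node [], .node [], .node []]]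
  have h3 := galtonWatson_node_ge κ (n + 3)
    [.node [.node [t, .node [], .node [], .node []]], .node [], .node [], .node []]
  simp only [List.length_cons, List.length_nil, List.map_cons, List.map_nil, List.prod_cons,
    List.prod_nil, mul_one, zero_add, Nat.reduceAdd] at h1 h2 h3
  have b0 := h0 n
  have b2 := h0 (n + 2)
  refine le_trans ?_ h3
  calc gadgetProb κ * galtonWatson κ (n + 1) t
      = poisson κ 4 * ((poisson κ 1 * (poisson κ 4 * (galtonWatson κ (n + 1) t *
        (poisson κ 0 * (poisson κ 0 * poisson κ 0))))) *
          (poisson κ 0 * (poisson κ 0 * poisson κ 0))) := by rw [gadgetProb]; ring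
    _ ≤ _ := by
        refine mul_le_mul_right (mul_le_mul' ((mul_le_mul_right (le_trans ?_ h1) _).trans h2) ?_) _
        · gcongr
        · gcongr

/-! ### The weight of the paths of a tree -/

/-- The total weight of the paths from the root of a tree to a fixed depth, where every edge has
weight `u` and there is an additional factor `q` whenever every third vertex starts a gadget. -/
def gadgetWeight (u q : ℝ≥0∞) : (r : ℕ) → Topo (r + 4) → ℝ≥0∞
  | 0, _ => 1
  | 1, t => (t.children.map fun c => u * gadgetWeight u q 0 c).sum
  | 2, t => (t.children.map fun c => u * gadgetWeight u q 1 c).sum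
  | r + 3, t =>
      open scoped Classical in
      (if t ∈ Set.range (Topo.gadget (n := r + 3)) then q else 1) *
        (t.children.map fun c => (c.children.map fun d => (d.children.map fun e =>
          u ^ 3 * gadgetWeight u q r e).sum).sum).sum

/-- Three levels without the factor `q` multiply the expectation by (κu)³. On the event that the
tree is a gadget, at least the fraction `q'` of its weight is lost, and this event carries at least
`gadgetProb κ` times the weight of the inner subtree. The loss stands on the left to avoid
subtraction in `ℝ≥0∞`. -/
theorem expect_gadgetWeight_step (κ : ℝ≥0) {u q q' : ℝ≥0∞} (hq : q + q' ≤ 1) (r : ℕ) :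
    expect (galtonWatson κ (r + 3 + 4)) (gadgetWeight u q (r + 3)) +
        q' * gadgetProb κ * u ^ 3 * expect (galtonWatson κ (r + 4)) (gadgetWeight u q r) ≤
      (κ * u) ^ 3 * expect (galtonWatson κ (r + 4)) (gadgetWeight u q r) := by
  classical
  set Z : Topo (r + 3 + 4) → ℝ≥0∞ := fun t =>
    (t.children.map fun c => (c.children.map fun d => (d.children.map fun e =>
      u ^ 3 * gadgetWeight u q r e).sum).sum).sum with hZ
  have hEZ : expect (galtonWatson κ (r + 3 + 4)) Z =
      (κ * u) ^ 3 * expect (galtonWatson κ (r + 4)) (gadgetWeight u q r) := by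
    rw [hZ, expect_galtonWatson_sum, expect_galtonWatson_sum, expect_galtonWatson_sum,
      expect_const_mul]
    ring
  have hlow : gadgetProb κ * u ^ 3 * expect (galtonWatson κ (r + 4)) (gadgetWeight u q r) ≤
      expect (galtonWatson κ (r + 3 + 4)) fun t =>
        if t ∈ Set.range (Topo.gadget (n := r + 3)) then Z t else 0 := by
    -- As the inner subtree determines the gadget, summing over inner subtrees counts each gadget
    -- once.
    refine le_trans ?_ (ENNReal.tsum_comp_le_tsum_of_injective
      (Topo.gadget_injective (n := r + 3)) _)
    rw [expect, ← ENNReal.tsum_mul_left]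
    refine ENNReal.tsum_le_tsum fun t => ?_
    simp only [Set.mem_range_self, if_true]
    have h1 : u ^ 3 * gadgetWeight u q r t ≤ Z t.gadget := by
      simp [hZ, Topo.gadget]
    calc gadgetProb κ * u ^ 3 * (galtonWatson κ (r + 4) t * gadgetWeight u q r t)
        = (gadgetProb κ * galtonWatson κ (r + 4) t) * (u ^ 3 * gadgetWeight u q r t) := by ring
      _ ≤ _ := mul_le_mul' (galtonWatson_gadget_ge κ (r + 3) t) h1
  rw [← hEZ]
  calc _ ≤ expect (galtonWatson κ (r + 3 + 4)) (gadgetWeight u q (r + 3)) +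
        q' * (expect (galtonWatson κ (r + 3 + 4)) fun t =>
          if t ∈ Set.range (Topo.gadget (n := r + 3)) then Z t else 0) := by
        rw [mul_assoc q', mul_assoc q']
        gcongr
    _ ≤ _ := by
        rw [← expect_const_mul, ← expect_add]
        refine expect_mono _ fun t => ?_
        have : gadgetWeight u q (r + 3) t =
          (if t ∈ Set.range (Topo.gadget (n := r + 3)) then q else 1) * Z t := rfl
        rw [this]
        split_ifs
        · rw [← add_mul]
          exact mul_le_of_le_one_left' hq
        · simp

theorem tendsto_zero_of_three_step {e : ℕ → ℝ≥0∞} {γ : ℝ≥0∞} (hγ : γ < 1)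
    (h0 : ∀ i < 3, e i ≠ ∞) (h : ∀ r, e (r + 3) ≤ γ * e r) :
    Filter.Tendsto e Filter.atTop (𝓝 0) := by
  have hb : ∀ r, e r ≤ γ ^ (r / 3) * (e 0 + e 1 + e 2) := by
    intro r
    induction r using Nat.strong_induction_on with
    | _ r ih =>
      match r, ih with
      | 0, _ => simp [add_assoc]
      | 1, _ => simp [add_comm (e 0), add_assoc]
      | 2, _ => simp
      | r + 3, ih =>
        rw [Nat.add_div_right _ (by norm_num), pow_succ']
        calc e (r + 3) ≤ γ * e r := h r
          _ ≤ γ * (γ ^ (r / 3) * (e 0 + e 1 + e 2)) := by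
              gcongr; exact ih r (by omega)
          _ = _ := by ring
  have hB : e 0 + e 1 + e 2 ≠ ∞ := by
    simp [h0 0 (by norm_num), h0 1 (by norm_num), h0 2 (by norm_num)]
  refine tendsto_of_tendsto_of_tendsto_of_le_of_le tendsto_const_nhds ?_ (fun _ => zero_le) hb
  have h1 : Filter.Tendsto (fun r : ℕ => γ ^ (r / 3)) Filter.atTop (𝓝 0) :=
    (ENNReal.tendsto_pow_atTop_nhds_zero_of_lt_one hγ).comp
      (Nat.tendsto_div_const_atTop (by norm_num))
  simpa using ENNReal.Tendsto.mul_const h1 (Or.inr hB)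

theorem tendsto_expect_gadgetWeight (κ : ℝ≥0) {u q q' γ : ℝ≥0∞} (hu : u ≠ ∞) (hq : q + q' ≤ 1)
    (hγ : γ < 1) (h : (κ * u) ^ 3 ≤ q' * gadgetProb κ * u ^ 3 + γ) :
    Filter.Tendsto (fun r => expect (galtonWatson κ (r + 4)) (gadgetWeight u q r)) Filter.atTop
      (𝓝 0) := by
  have hstep := expect_gadgetWeight_step κ (u := u) hq
  have e0 : expect (galtonWatson κ (0 + 4)) (gadgetWeight u q 0) = 1 := by
    simp [gadgetWeight]
  have e1 : expect (galtonWatson κ (1 + 4)) (gadgetWeight u q 1) = κ * u := by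
    have : gadgetWeight u q 1 = fun t : Topo (4 + 1) => (t.children.map fun c =>
      u * gadgetWeight u q 0 c).sum := rfl
    rw [this]
    refine (expect_galtonWatson_sum κ 4 _).trans ?_
    rw [expect_const_mul]
    rw [show expect (galtonWatson κ 4) (gadgetWeight u q 0) = 1 from e0, mul_one]
  have e2 : expect (galtonWatson κ (2 + 4)) (gadgetWeight u q 2) = κ * (u * (κ * u)) := by
    have : gadgetWeight u q 2 = fun t : Topo (5 + 1) => (t.children.map fun c =>
      u * gadgetWeight u q 1 c).sum := rfl
    rw [this]
    refine (expect_galtonWatson_sum κ 5 _).trans ?_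
    rw [expect_const_mul]
    rw [show expect (galtonWatson κ 5) (gadgetWeight u q 1) = _ from e1]
  have hκu : (κ : ℝ≥0∞) * u ≠ ∞ := ENNReal.mul_ne_top ENNReal.coe_ne_top hu
  have h0 : ∀ i < 3, expect (galtonWatson κ (i + 4)) (gadgetWeight u q i) ≠ ∞ := by
    intro i hi
    interval_cases i
    · rw [e0]; simp
    · rw [e1]; exact hκu
    · rw [e2]; exact ENNReal.mul_ne_top ENNReal.coe_ne_top (ENNReal.mul_ne_top hu hκu)
  -- Finiteness is what permits cancelling the loss term from both sides at the end.
  have hfin : ∀ i, expect (galtonWatson κ (i + 4)) (gadgetWeight u q i) ≠ ∞ := by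
    intro i
    induction i using Nat.strong_induction_on with
    | _ i ih =>
      by_cases hi : i < 3
      · exact h0 i hi
      · obtain ⟨r, rfl⟩ : ∃ r, i = r + 3 := ⟨i - 3, by omega⟩
        exact ne_top_of_le_ne_top (ENNReal.mul_ne_top (ENNReal.pow_ne_top hκu) (ih r (by omega)))
          (le_self_add.trans (hstep r))
  refine tendsto_zero_of_three_step hγ h0 fun r => ?_
  have h1 := (hstep r).trans (mul_le_mul_left h _)
  rw [add_mul, add_comm] at h1
  have hq' : q' ≠ ∞ := ne_top_of_le_ne_top ENNReal.one_ne_top (le_add_self.trans hq)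
  have hg : gadgetProb κ ≠ ∞ := by
    simp only [gadgetProb]
    exact ENNReal.mul_ne_top (ENNReal.mul_ne_top (ENNReal.pow_ne_top (PMF.apply_ne_top _ _))
      (PMF.apply_ne_top _ _)) (ENNReal.pow_ne_top (PMF.apply_ne_top _ _))
  exact (ENNReal.add_le_add_iff_left (ENNReal.mul_ne_top (ENNReal.mul_ne_top
    (ENNReal.mul_ne_top hq' hg) (ENNReal.pow_ne_top hu)) (hfin r))).1 h1

/-! ### Shapes of labelled trees -/

/-- Forget the labels. -/
def LTree.skel {α : Type} : {n : ℕ} → LTree α n → LTree Unit n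
  | 0, _ => .leaf ()
  | _ + 1, t => .node () (t.2.map LTree.skel)

/-- Forget the order of the children. -/
def Topo.forget : {n : ℕ} → Topo n → LTree Unit n
  | 0, _ => .leaf ()
  | _ + 1, t => .node () (t.children.map Topo.forget : List _)

section Shape

variable {α : Type} {n : ℕ}

theorem LTree.exists_eq_node (t : LTree α (n + 1)) : ∃ x m, t = LTree.node x m := ⟨t.1, t.2, rfl⟩

@[simp]
theorem LTree.skel_node (x : α) (m : Multiset (LTree α n)) :
    (LTree.node x m).skel = .node () (m.map LTree.skel) := rfl

@[simp]
theorem Topo.forget_node (l : List (Topo n)) :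
    (Topo.node l).forget = .node () (l.map Topo.forget : List _) := rfl

@[simp]
theorem LTree.numChildren_node (x : α) (m : Multiset (LTree α n)) :
    (LTree.node x m).numChildren = m.card := rfl

@[simp]
theorem LTree.mapChildren_node {β : Type} (f : {m : ℕ} → LTree α m → β) (x : α)
    (m : Multiset (LTree α n)) : (LTree.node x m).mapChildren f = m.map f := rfl

@[simp]
theorem LTree.numChildren_skel (t : LTree α n) : t.skel.numChildren = t.numChildren := by
  cases n with
  | zero => rfl
  | succ n =>
    obtain ⟨x, m, rfl⟩ := t.exists_eq_node
    simp

theorem LTree.mapChildren_skel {β : Type} (f : {m : ℕ} → LTree Unit m → β)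
    (g : {m : ℕ} → LTree α m → β) (h : ∀ {m : ℕ} (t : LTree α m), f t.skel = g t)
    (t : LTree α n) : t.skel.mapChildren f = t.mapChildren g := by
  cases n with
  | zero => rfl
  | succ n =>
    obtain ⟨x, m, rfl⟩ := t.exists_eq_node
    simp [h]

@[simp]
theorem vertexDegree_skel (p : Option ParentInfo) (t : LTree α n) :
    vertexDegree p t.skel = vertexDegree p t := by
  simp [vertexDegree]

@[simp]
theorem isGood_skel (d : Option ℕ) (t : LTree α n) : isGood d t.skel = isGood d t := by
  have : nbrDegrees d t.skel = nbrDegrees d t := by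
    rw [nbrDegrees, LTree.mapChildren_skel _ (fun c => c.numChildren + 1) (fun t => by simp)]
    rfl
  simp only [isGood, this]

-- Marks do not see spins or coins, so conditioning on the topology fixes them.
@[simp]
theorem isMarked_skel (p : Option ParentInfo) (t : LTree α n) :
    isMarked p t.skel = isMarked p t := by
  have : nbrGood p t.skel = nbrGood p t := by
    rw [nbrGood, vertexDegree_skel,
      LTree.mapChildren_skel _ (fun c => isGood (some (vertexDegree p t)) c) (fun t => by simp)]
    rfl
  simp only [isMarked, vertexDegree_skel, this]

end Shape

theorem map_eq_of_mem_support_indepMultiset {α β γ : Type} {Q : α → PMF β} {f : β → γ} {g : α → γ}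
    {l : List α} (h : ∀ a ∈ l, ∀ x ∈ (Q a).support, f x = g a) {m : Multiset β}
    (hm : m ∈ (indepMultiset Q l).support) : m.map f = (l.map g : List γ) := by
  induction l generalizing m with
  | nil =>
    have : m = 0 := by simpa [indepMultiset] using hm
    simp [this]
  | cons a l ih =>
    rw [indepMultiset, PMF.mem_support_bind_iff] at hm
    obtain ⟨x, hx, hm⟩ := hm
    rw [PMF.mem_support_map_iff] at hm
    obtain ⟨m', hm', rfl⟩ := hm
    rw [Multiset.map_cons, ih (fun b hb => h b (List.mem_cons_of_mem _ hb)) hm',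
      h a (List.mem_cons_self) x hx]
    rfl

section SpinLaw

variable {β : Type} {p q : ℝ≥0} (h : p + q = 1) (μ : PMF β)

theorem label_of_mem_support_spinLaw {n : ℕ} {t : Topo n} {s : ℤˣ} {x : LTree (ℤˣ × β) n}
    (hx : x ∈ (spinLaw h μ n t s).support) : x.label.1 = s := by
  cases n with
  | zero =>
    rw [spinLaw_zero, PMF.mem_support_map_iff] at hx
    obtain ⟨c, _, rfl⟩ := hx
    rfl
  | succ n =>
    obtain ⟨l, ht⟩ := t.exists_eq_node
    rw [ht, spinLaw_node, PMF.mem_support_bind_iff] at hx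
    obtain ⟨c, _, hx⟩ := hx
    rw [PMF.mem_support_map_iff] at hx
    obtain ⟨m, _, rfl⟩ := hx
    rfl

theorem skel_of_mem_support_spinLaw {n : ℕ} {t : Topo n} {s : ℤˣ} {x : LTree (ℤˣ × β) n}
    (hx : x ∈ (spinLaw h μ n t s).support) : x.skel = t.forget := by
  induction n generalizing s with
  | zero => rfl
  | succ n ih =>
    obtain ⟨l, ht⟩ := t.exists_eq_node
    rw [ht, spinLaw_node, PMF.mem_support_bind_iff] at hx
    obtain ⟨c, _, hx⟩ := hx
    rw [PMF.mem_support_map_iff] at hx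
    obtain ⟨m, hm, rfl⟩ := hx
    rw [ht, LTree.skel_node, Topo.forget_node]
    congr 1
    refine map_eq_of_mem_support_indepMultiset (fun t _ x hx => ?_) hm
    rw [PMF.mem_support_bind_iff] at hx
    obtain ⟨s', _, hx⟩ := hx
    exact ih hx

theorem skel_children_of_mem_support {n : ℕ} {l : List (Topo n)} {s : ℤˣ}
    {m : Multiset (LTree (ℤˣ × β) n)}
    (hm : m ∈ (indepMultiset (fun t => (noisySpin h s).bind fun s' => spinLaw h μ n t s')
      l).support) : m.map LTree.skel = (l.map Topo.forget : List _) := by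
  refine map_eq_of_mem_support_indepMultiset (fun t _ x hx => ?_) hm
  rw [PMF.mem_support_bind_iff] at hx
  obtain ⟨s', _, hx⟩ := hx
  exact skel_of_mem_support_spinLaw h μ hx

end SpinLaw

/-! ### Annotations and views -/

/-- Replace the spin. -/
def ParentInfo.withSpin (i : ParentInfo) (s : ℤˣ) : ParentInfo := ⟨i.deg, i.good, s⟩

/-- The data of a vertex that its children need, with a dummy spin. -/
def topoInfo {n : ℕ} (p : Option ParentInfo) (t : LTree Unit n) : ParentInfo :=
  ⟨vertexDegree p t, isGood (p.map ParentInfo.deg) t, 1⟩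

theorem infoForChildren_eq {n : ℕ} (p : Option ParentInfo) (t : LTree (ℤˣ × Bool) n) :
    infoForChildren p t = (topoInfo p t.skel).withSpin t.label.1 := by
  simp [infoForChildren, topoInfo, ParentInfo.withSpin]

theorem isMarked_withSpin {α : Type} {n : ℕ} (i : ParentInfo) (s : ℤˣ) (t : LTree α n) :
    isMarked (some (i.withSpin s)) t = isMarked (some i) t := rfl

theorem topoInfo_withSpin {n : ℕ} (i : ParentInfo) (s : ℤˣ) (t : LTree Unit n) :
    topoInfo (some (i.withSpin s)) t = topoInfo (some i) t := rfl

theorem annotate_node {n : ℕ} (p : Option ParentInfo) (x : ℤˣ × Bool)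
    (m : Multiset (LTree (ℤˣ × Bool) n)) :
    annotate p (LTree.node x m) = LTree.node (vertexData p (LTree.node x m))
      (m.map (annotate (some (infoForChildren p (LTree.node x m))))) := rfl

theorem label_annotate {n : ℕ} (p : Option ParentInfo) (t : LTree (ℤˣ × Bool) n) :
    (annotate p t).label = vertexData p t := by
  cases n <;> rfl

theorem isCut_eq_false {n : ℕ} {p : Option ParentInfo} {t : LTree (ℤˣ × Bool) n}
    (h : isMarked p t = false) : isCut p t = false := by
  simp [isCut, h]

/-- The spin of the parent matters only for deciding whether this vertex is cut, which is impossible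
for an unmarked vertex. Hence below an unmarked vertex the parent's spin acts only through the spin
of the vertex itself. -/
theorem annotate_withSpin {n : ℕ} {i : ParentInfo} {t : LTree (ℤˣ × Bool) n}
    (h : isMarked (some i) t = false) (s : ℤˣ) :
    annotate (some (i.withSpin s)) t = annotate (some i) t := by
  have hv : vertexData (some (i.withSpin s)) t = vertexData (some i) t := by
    have h' : isMarked (some (i.withSpin s)) t = false := h
    simp only [vertexData, h, h', isCut_eq_false h, isCut_eq_false h']
    rfl
  cases n with
  | zero => exact hv
  | succ n =>
    obtain ⟨x, m, rfl⟩ := t.exists_eq_node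
    rw [annotate_node, annotate_node, hv]
    rfl

/-- What is observed of the subtree hanging from a vertex. -/
def cutView (R : ℕ) (t : LTree VertexData (R + 3)) : LTree VertexView R :=
  observe (component t).dropLevel.dropLevel.dropLevel

/-- What a child contributes to the observation of its parent, if the parent is not cut. -/
def childView (R : ℕ) (t : LTree VertexData (R + 3)) : Multiset (LTree VertexView R) :=
  if t.label.cut then 0 else {cutView R t}

theorem component_node {n : ℕ} (x : VertexData) (m : Multiset (LTree VertexData n)) :
    component (LTree.node x m) =
      LTree.node x ((m.filter fun c => x.cut = false ∧ c.label.cut = false).map component) := rfl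

theorem dropLevel_node {α : Type} {n : ℕ} (x : α) (m : Multiset (LTree α (n + 1))) :
    (LTree.node x m).dropLevel = LTree.node x (m.map LTree.dropLevel) := rfl

theorem observe_node {n : ℕ} (x : VertexData) (m : Multiset (LTree VertexData (n + 1))) :
    observe (LTree.node x m) = LTree.node x.viewInner (m.map observe) := rfl

theorem cutView_node_of_cut {R : ℕ} {x : VertexData} (hx : x.cut = true)
    (m : Multiset (LTree VertexData (R + 4))) :
    cutView (R + 2) (LTree.node x m) = LTree.node x.viewInner 0 := by
  rw [cutView, component_node, dropLevel_node, dropLevel_node, dropLevel_node, observe_node]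
  simp [hx]

/-- The height `R + 2` keeps the root away from the bottom: exposure of a parent as a leaf occurs
only at height 1. -/
theorem cutView_node {R : ℕ} {x : VertexData} (hx : x.cut = false)
    (m : Multiset (LTree VertexData (R + 4))) :
    cutView (R + 2) (LTree.node x m) = LTree.node x.viewInner (m.bind (childView (R + 1))) := by
  rw [cutView, component_node, dropLevel_node, dropLevel_node, dropLevel_node, observe_node]
  simp only [hx, true_and, Multiset.map_map]
  congr 1
  induction m using Multiset.induction_on with
  | empty => rfl
  | cons c m ih =>
    rw [Multiset.cons_bind, ← ih, childView]
    by_cases hc : c.label.cut = true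
    · rw [Multiset.filter_cons_of_neg _ (by simp [hc])]
      simp [hc]
    · rw [Multiset.filter_cons_of_pos _ (by simpa using hc)]
      simp only [hc, Multiset.map_cons]
      rfl

theorem label_component {n : ℕ} (t : LTree VertexData n) : (component t).label = t.label := by
  cases n <;> rfl

theorem label_dropLevel {α : Type} {n : ℕ} (t : LTree α (n + 1)) : t.dropLevel.label = t.label := by
  cases n <;> rfl

/-- Unlike `cutView_node`, this includes observed height 1. There the only child is a bottom vertex,
and being unmarked it is not trimmed. -/
theorem cutView_node_singleton {R : ℕ} {x : VertexData} (hx : x.cut = false)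
    {t : LTree VertexData (R + 3)} (ht : t.label.cut = false) (ht' : t.label.marked = false) :
    cutView (R + 1) (LTree.node x {t}) = LTree.node x.viewInner {cutView R t} := by
  cases R with
  | succ R => rw [cutView_node hx]; simp [childView, ht]
  | zero =>
    have h1 : (component (LTree.node x ({t} : Multiset (LTree VertexData 3)))) =
        LTree.node x {component t} := by
      rw [component_node]; simp [hx, ht, Multiset.filter_singleton]
    have h2 : ((component t).dropLevel.dropLevel.dropLevel).label.marked = false := by
      rw [label_dropLevel, label_dropLevel, label_dropLevel, label_component, ht']
    have h3 : ∀ y : LTree VertexData 0, y.label.marked = false →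
        observe (LTree.node x {y}) = LTree.node x.viewInner {observe y} := by
      intro y hy
      have : observe (LTree.node x {y}) = if true ∈ ({y} : Multiset (LTree VertexData 0)).map
          (fun c => (LTree.label c).marked) then LTree.node x.viewLeaf 0
          else LTree.node x.viewInner (({y} : Multiset (LTree VertexData 0)).map observe) := rfl
      rw [this, Multiset.map_singleton, Multiset.map_singleton, if_neg (by simp [hy])]
    rw [cutView]
    erw [h1]
    exact h3 _ h2

/-- A parent of degree 2 does not count towards goodness, so a good vertex below it has at least
three children and thus degree at least 4. In particular the child of a marked vertex is never
marked. -/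
theorem not_isMarked_of_isGood {n : ℕ} (i : ParentInfo) {t : LTree Unit n}
    (ht : isGood (some 2) t = true) : isMarked (some i) t = false := by
  cases n with
  | zero => simp [isGood, nbrDegrees, LTree.mapChildren, Multiset.countP_eq_card_filter,
      Multiset.filter_singleton] at ht
  | succ n =>
    obtain ⟨x, m, rfl⟩ := t.exists_eq_node
    have h1 : 3 ≤ m.card := by
      simp only [isGood, nbrDegrees, Option.elim, LTree.mapChildren_node, decide_eq_true_eq,
        Multiset.countP_add] at ht
      have := Multiset.countP_le_card (fun x => x ≠ 2) (m.map fun c => c.numChildren + 1)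
      rw [Multiset.card_map] at this
      have h2 : Multiset.countP (fun x => x ≠ 2) ({2} : Multiset ℕ) = 0 := rfl
      omega
    simp only [isMarked, vertexDegree, LTree.numChildren_node, Option.isSome_some, if_true,
      decide_eq_false_iff_not]
    rintro ⟨h, -⟩
    omega

/-! ### Contraction of information along edges and marked vertices -/

theorem InfoLE.indepMultiset {A X Y : Type} {Q : ℤˣ → A → PMF X} {f : ℤˣ → X → Multiset Y}
    {w : A → ℝ≥0∞} {l : List A} (H : ∀ a ∈ l, InfoLE (fun s => (Q s a).map (f s)) (w a)) :
    InfoLE (fun s => (indepMultiset (Q s) l).map fun m => m.bind (f s)) (l.map w).sum := by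
  induction l with
  | nil =>
    simp only [_root_.indepMultiset, PMF.pure_map]
    exact infoLE_const _
  | cons a l ih =>
    have h1 := ((H a List.mem_cons_self).prod
      (ih fun b hb => H b (List.mem_cons_of_mem _ hb))).map fun z : _ × _ => z.1 + z.2
    rw [List.map_cons, List.sum_cons]
    convert h1 using 2 with s
    refine pmf_ext_expect fun g => ?_
    simp only [_root_.indepMultiset, expect_map, expect_bind, Multiset.cons_bind]

/-- The law of the part of the observation that a child contributes to that of its parent. -/
def childLaw {p q : ℝ≥0} (h : p + q = 1) (μ : PMF Bool) (R : ℕ) (i : ParentInfo) (t : Topo (R + 3))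
    (s : ℤˣ) : PMF (Multiset (LTree VertexView R)) :=
  ((noisySpin h s).bind fun s' => spinLaw h μ (R + 3) t s').map fun x =>
    childView R (annotate (some (i.withSpin s)) x)

/-- The law of the observation of the subtree hanging from a vertex. -/
def viewLaw {p q : ℝ≥0} (h : p + q = 1) (μ : PMF Bool) (R : ℕ) (i : Option ParentInfo)
    (t : Topo (R + 3)) (s : ℤˣ) : PMF (LTree VertexView R) :=
  (spinLaw h μ (R + 3) t s).map fun x => cutView R (annotate i x)

section

variable {p q : ℝ≥0} (h : p + q = 1) (μ : PMF Bool)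

/-- An unmarked vertex is never cut, so given its spin the contributions of its children are
independent, and its own label in the view is fixed by the topology. Subadditivity then applies. -/
theorem infoLE_viewLaw_of_children {R : ℕ} {i : Option ParentInfo} {l : List (Topo (R + 4))}
    (hm : isMarked i (Topo.node l).forget = false) {w : Topo (R + 4) → ℝ≥0∞}
    (H : ∀ t ∈ l, InfoLE (childLaw h μ (R + 1) (topoInfo i (Topo.node l).forget) t) (w t)) :
    InfoLE (viewLaw h μ (R + 2) i (Topo.node l)) (l.map w).sum := by
  set τ : LTree Unit (R + 5) := (Topo.node l).forget with hτ
  set j := topoInfo i τ with hj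
  have h1 := (InfoLE.indepMultiset (Q := fun s t => (noisySpin h s).bind fun s' =>
    spinLaw h μ (R + 4) t s') (f := fun s x => childView (R + 1) (annotate (some (j.withSpin s)) x))
    (w := w) (l := l) H).map fun m => LTree.node (⟨j.good, false, none⟩ : VertexView) m
  convert h1 using 2 with s
  rw [viewLaw, spinLaw_node, PMF.map_bind]
  -- The coin of an unmarked vertex has no effect, so it is reintroduced as a dummy to match the two
  -- laws.
  rw [← PMF.bind_const μ (PMF.map _ (PMF.map _ _))]
  congr 1; funext c
  rw [PMF.map_comp, PMF.map_comp]
  refine pmf_map_congr fun m hm' => ?_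
  have hsk : (LTree.node (s, c) m).skel = τ := by
    rw [LTree.skel_node, skel_children_of_mem_support h μ hm', hτ, Topo.forget_node]
  have hmk : isMarked i (LTree.node (s, c) m) = false := by
    rw [← isMarked_skel, hsk, hm]
  have hg : isGood (i.map ParentInfo.deg) (LTree.node (s, c) m) = j.good := by
    rw [← isGood_skel, hsk]; rfl
  simp only [Function.comp_apply]
  rw [annotate_node, cutView_node (isCut_eq_false hmk), infoForChildren_eq, hsk,
    Multiset.bind_map]
  congr 1
  simp only [VertexData.viewInner, vertexData, hmk, hg]

/-- `InfoLE.noisy` with weights p and q and no erasure: since p + q = 1, the factor is (p - q)². -/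
theorem infoLE_childLaw_of_not_isMarked {R : ℕ} {i : ParentInfo} {t : Topo (R + 3)}
    (hm : isMarked (some i) t.forget = false) {w : ℝ≥0∞}
    (H : InfoLE (viewLaw h μ R (some i) t) w) :
    InfoLE (childLaw h μ R i t) (ENNReal.ofReal (((p : ℝ) - q) ^ 2) * w) := by
  have hpq : (p : ℝ) + q = 1 := by exact_mod_cast h
  have h1 := (H.map fun v => ({v} : Multiset _)).noisy
    (K := childLaw h μ R i t) (J := fun _ _ => 0) p.coe_nonneg q.coe_nonneg (by simp [hpq])
    (fun _ => by
      have : 2 * (1 - (p : ℝ) - q) = 0 := by linarith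
      simp [this]) ?_
  · simpa [hpq] using h1
  · intro s g
    have e : ∀ s' s'' : ℤˣ, (expect (spinLaw h μ (R + 3) t s') fun x =>
        g (childView R (annotate (some (i.withSpin s'')) x))) =
        expect (spinLaw h μ (R + 3) t s') fun x => g {cutView R (annotate (some i) x)} := by
      intro s' s''
      refine expect_congr fun x hx => ?_
      have hmk : isMarked (some i) x = false := by
        rw [← isMarked_skel, skel_of_mem_support_spinLaw h μ hx, hm]
      rw [annotate_withSpin hmk, childView, label_annotate]
      simp [vertexData, isCut_eq_false hmk]
    simp only [childLaw, viewLaw, expect_map, expect_bind, expect_noisySpin, e, zero_add,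
      ENNReal.ofReal_coe_nnreal]

theorem isMarked_some_forget {n : ℕ} {i : ParentInfo} {t : Topo (n + 1)}
    (hm : isMarked (some i) t.forget = true) : ∃ c, t = .node [c] ∧
      isGood (some 2) c.forget = true := by
  obtain ⟨l, ht⟩ := t.exists_eq_node
  rw [ht] at hm ⊢
  simp only [isMarked, vertexDegree, nbrGood, Topo.forget_node, LTree.numChildren_node,
    LTree.mapChildren_node, decide_eq_true_eq, Option.isSome_some, if_true, Multiset.coe_card,
    List.length_map] at hm
  obtain ⟨h1, h2⟩ := hm
  obtain ⟨c, rfl⟩ := List.length_eq_one_iff.1 (by omega : l.length = 1)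
  refine ⟨c, rfl, h2 _ ?_⟩
  simp

theorem expect_childLaw_node_singleton {R : ℕ} {i j : ParentInfo} {c : Topo (R + 3)}
    (hj : j = topoInfo (some i) (Topo.node [c]).forget)
    (hm : isMarked (some i) (Topo.node [c]).forget = true) (hg : isGood (some 2) c.forget = true)
    (g : Multiset (LTree VertexView (R + 1)) → ℝ≥0∞) (s s' s'' : ℤˣ) (b : Bool) :
    (expect (spinLaw h μ (R + 3) c s'') fun z => g (childView (R + 1)
      (annotate (some (i.withSpin s)) (LTree.node (s', b) {z})))) =
    if s = -s' ∧ s'' = -s' ∧ b = true then g 0 else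
      expect ((viewLaw h μ R (some j) c s'').map fun v =>
        ({LTree.node (⟨j.good, true, none⟩ : VertexView) {v}} : Multiset _)) g := by
  have hview : ∀ z ∈ (spinLaw h μ (R + 3) c s'').support, childView (R + 1)
      (annotate (some (i.withSpin s)) (LTree.node (s', b) {z})) =
      if s = -s' ∧ s'' = -s' ∧ b = true then 0 else
        {LTree.node (⟨j.good, true, none⟩ : VertexView) {cutView R (annotate (some j) z)}} := by
    intro z hz
    have hskz := skel_of_mem_support_spinLaw h μ hz
    have hlz := label_of_mem_support_spinLaw h μ hz
    set y : LTree (ℤˣ × Bool) (R + 3 + 1) := LTree.node (s', b) {z} with hy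
    have hsk : y.skel = (Topo.node [c]).forget := by simp [hy, hskz]
    have hmk : isMarked (some (i.withSpin s)) y = true := by
      rw [isMarked_withSpin, ← isMarked_skel, hsk, hm]
    have hmz : isMarked (some j) z = false := by
      rw [← isMarked_skel, hskz]
      exact not_isMarked_of_isGood j hg
    have hgood : isGood (some i.deg) y = j.good := by
      rw [← isGood_skel, hsk, hj]; rfl
    have hinfo : infoForChildren (some (i.withSpin s)) y = j.withSpin s' := by
      rw [infoForChildren_eq, hsk, topoInfo_withSpin, ← hj]; rfl
    have hcut : isCut (some (i.withSpin s)) y = decide (s = -s' ∧ s'' = -s' ∧ b = true) := by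
      have hn : nbrSpins (some (i.withSpin s)) y = {s} + {s''} := by
        rw [← hlz]; rfl
      have hl : y.label = (s', b) := rfl
      simp only [isCut, hmk, hn, hl]
      cases b <;> simp
    rw [childView, label_annotate]
    by_cases hc : s = -s' ∧ s'' = -s' ∧ b = true
    · have hcut' : isCut (some (i.withSpin s)) y = true := by rw [hcut]; exact decide_eq_true hc
      rw [if_pos hc, if_pos (by simp [vertexData, hcut'])]
    · have hcut' : isCut (some (i.withSpin s)) y = false := by rw [hcut]; simp [hc]
      rw [if_neg hc, if_neg (by simp [vertexData, hcut'])]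
      congr 1
      rw [hy, annotate_node, ← hy, hinfo, Multiset.map_singleton, annotate_withSpin hmz,
        cutView_node_singleton]
      · congr 1
        simp only [VertexData.viewInner, vertexData, hmk]
        rw [← hgood]; rfl
      · exact hcut'
      · rw [label_annotate]; exact isCut_eq_false hmz
      · rw [label_annotate]; exact hmz
  rw [expect_congr fun z hz => congrArg g (hview z hz)]
  split_ifs with hc
  · simp
  · simp only [viewLaw, expect_map]

/-- The two edges at the marked vertex are treated as one noisy channel from its parent to its child
`c`. The ends agree and stay connected with weight A = p² + q²(1 - d), and they disagree with weight
B = 2pq. With weight dq² the vertex is cut, whatever the parent's spin, and the parent receives the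
symbol 0. Here A - B = (p - q)² - dq² and A + B = 1 - dq². -/
theorem infoLE_childLaw_of_isMarked {d : ℝ} (hd0 : 0 ≤ d) (hd1 : d ≤ 1)
    (hμ : ∀ g, expect μ g = ENNReal.ofReal d * g true + ENNReal.ofReal (1 - d) * g false)
    (hp : 0 < p) {R : ℕ} {i : ParentInfo} {c : Topo (R + 3)}
    (hm : isMarked (some i) (Topo.node [c]).forget = true) (hg : isGood (some 2) c.forget = true)
    {w : ℝ≥0∞}
    (H : InfoLE (viewLaw h μ R (some (topoInfo (some i) (Topo.node [c]).forget)) c) w) :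
    InfoLE (childLaw h μ (R + 1) i (Topo.node [c]))
      (ENNReal.ofReal ((((p : ℝ) - q) ^ 2 - d * q ^ 2) ^ 2 / (1 - d * q ^ 2)) * w) := by
  have hpq : (p : ℝ) + q = 1 := by exact_mod_cast h
  have hp' : (0 : ℝ) < p := hp
  have hd1' : 0 ≤ 1 - d := sub_nonneg.2 hd1
  have h1 := (H.map fun v => ({LTree.node (⟨(topoInfo (some i) (Topo.node [c]).forget).good,
      true, none⟩ : VertexView) {v}} : Multiset _)).noisy
    (K := childLaw h μ (R + 1) i (Topo.node [c]))
    (J := fun _ g => ENNReal.ofReal (d * q ^ 2) * g 0)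
    (A := (p : ℝ) ^ 2 + q ^ 2 * (1 - d)) (B := 2 * (p * q)) (by positivity) (by positivity)
    (by positivity) (fun f => by
      rw [← mul_add]
      refine le_trans (le_of_eq ?_) (mul_le_mul_right (ofReal_sq_add_sq_ge (f 0)) _)
      rw [show (2 : ℝ≥0∞) = ENNReal.ofReal 2 by simp, ← ENNReal.ofReal_mul (by positivity)]
      congr 1
      linear_combination (-2 * ((p : ℝ) + q + 1)) * hpq) ?_
  · convert h1 using 4
    · ring
    · linear_combination (-((p : ℝ) + q + 1)) * hpq
  · intro s g
    set L : ℤˣ → ℝ≥0∞ := fun s'' => expect ((viewLaw h μ R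
      (some (topoInfo (some i) (Topo.node [c]).forget)) c s'').map fun v =>
        ({LTree.node (⟨(topoInfo (some i) (Topo.node [c]).forget).good, true, none⟩ : VertexView)
          {v}} : Multiset _)) g with hL
    have key : ∀ s' s'' b, (expect (spinLaw h μ (R + 3) c s'') fun z => g (childView (R + 1)
        (annotate (some (i.withSpin s)) (LTree.node (s', b) {z})))) =
        if s = -s' ∧ s'' = -s' ∧ b = true then g 0 else L s'' :=
      expect_childLaw_node_singleton h μ rfl hm hg g s
    have hL' : ∀ s'', expect (PMF.map _ _) g = L s'' := fun _ => rfl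
    rw [hL', hL']
    clear_value L
    have e : expect (childLaw h μ (R + 1) i (Topo.node [c]) s) g =
        p * (ENNReal.ofReal d * (p * L s + q * L (-s)) +
            ENNReal.ofReal (1 - d) * (p * L s + q * L (-s))) +
        q * (ENNReal.ofReal d * (p * L (-s) + q * g 0) +
            ENNReal.ofReal (1 - d) * (p * L (-s) + q * L s)) := by
      have hs : s ≠ -s := by rcases Int.units_eq_one_or s with h | h <;> simp [h]
      rw [childLaw, expect_map, expect_bind, expect_noisySpin]
      erw [spinLaw_node, spinLaw_node]
      simp only [indepMultiset, expect_bind, expect_map, expect_pure, hμ, expect_noisySpin,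
        Multiset.cons_zero, key, neg_neg]
      simp [hs, hs.symm]
    rw [e]
    simp only [ENNReal.ofReal_add (by positivity : (0 : ℝ) ≤ (p : ℝ) ^ 2)
      (by positivity : (0 : ℝ) ≤ q ^ 2 * (1 - d)), ENNReal.ofReal_mul hd0,
      ENNReal.ofReal_mul (by positivity : (0 : ℝ) ≤ (q : ℝ) ^ 2),
      ENNReal.ofReal_mul zero_le_two, ENNReal.ofReal_mul p.coe_nonneg,
      ENNReal.ofReal_pow p.coe_nonneg, ENNReal.ofReal_pow q.coe_nonneg, ENNReal.ofReal_coe_nnreal,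
      ENNReal.ofReal_ofNat]
    have hdd : ENNReal.ofReal d + ENNReal.ofReal (1 - d) = 1 := by
      rw [← ENNReal.ofReal_add hd0 hd1']; simp
    calc _ = (ENNReal.ofReal d + ENNReal.ofReal (1 - d)) * (p * (p * L s + q * L (-s)))
          + (ENNReal.ofReal d + ENNReal.ofReal (1 - d)) * (q * (p * L (-s)))
          + ENNReal.ofReal d * q ^ 2 * g 0 + q ^ 2 * ENNReal.ofReal (1 - d) * L s := by ring
      _ = _ := by rw [hdd]; ring

end

/-- The total weight of the paths from a vertex to a fixed depth: edges have weight `u`, and there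
is an additional factor `Q` for every marked vertex on the path. -/
def pathWeight (u Q : ℝ≥0∞) : (r : ℕ) → Option ParentInfo → Topo (r + 4) → ℝ≥0∞
  | 0, _, _ => 1
  | r + 1, i, t => (t.children.map fun c =>
      u * (if isMarked (some (topoInfo i t.forget)) c.forget then Q else 1) *
        pathWeight u Q r (some (topoInfo i t.forget)) c).sum

section

variable {p q : ℝ≥0} (h : p + q = 1) (μ : PMF Bool)

/-- An unmarked child costs one edge factor `u`. A marked child is passed together with its own only
child, at the cost `u * Q * u`; that grandchild is good, hence unmarked, and the induction resumes
there. Paths are followed only to one level above the bottom of the view. -/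
theorem infoLE_viewLaw {d : ℝ} (hd0 : 0 ≤ d) (hd1 : d ≤ 1)
    (hμ : ∀ g, expect μ g = ENNReal.ofReal d * g true + ENNReal.ofReal (1 - d) * g false)
    (hp : 0 < p) {u Q : ℝ≥0∞} (hu : u = ENNReal.ofReal (((p : ℝ) - q) ^ 2)) (hu1 : u ≤ 1)
    (hQ : ENNReal.ofReal ((((p : ℝ) - q) ^ 2 - d * q ^ 2) ^ 2 / (1 - d * q ^ 2)) ≤ u * Q * u)
    (r : ℕ) (i : Option ParentInfo) (t : Topo (r + 4)) (hm : isMarked i t.forget = false) :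
    InfoLE (viewLaw h μ (r + 1) i t) (pathWeight u Q r i t) := by
  induction r using Nat.strong_induction_on generalizing i with
  | _ r ih =>
    match r, ih with
    -- The trivial bound at observed height 1 covers every case of trimming and exposed parents.
    | 0, _ => exact infoLE_of_one_le _ le_rfl
    | r + 1, ih =>
      obtain ⟨l, ht⟩ := t.exists_eq_node
      rw [ht] at hm ⊢
      refine infoLE_viewLaw_of_children h μ hm fun c _ => ?_
      by_cases hc : isMarked (some (topoInfo i (Topo.node l).forget)) c.forget = true
      · rw [if_pos hc]
        obtain ⟨c', hc', hg⟩ := isMarked_some_forget hc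
        match r, ih with
        -- The path ends at the marked child, so its weight has a single edge factor; `u ≤ 1` makes
        -- up for the second.
        | 0, _ =>
          rw [hc'] at hc ⊢
          refine (infoLE_childLaw_of_isMarked h μ hd0 hd1 hμ hp hc hg
            (infoLE_of_one_le _ le_rfl)).mono ?_
          rw [pathWeight]
          gcongr
          exact hQ.trans (mul_le_of_le_one_right' hu1)
        | r + 1, ih =>
          rw [hc'] at hc ⊢
          refine (infoLE_childLaw_of_isMarked h μ hd0 hd1 hμ hp hc hg
            (ih r (by omega) _ _ (not_isMarked_of_isGood _ hg))).mono ?_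
          rw [pathWeight, Topo.children_node, List.map_singleton, List.sum_singleton,
            not_isMarked_of_isGood _ hg, if_neg Bool.false_ne_true, mul_one, ← mul_assoc]
          gcongr
      · rw [if_neg hc, mul_one]
        rw [Bool.not_eq_true] at hc
        have := infoLE_childLaw_of_not_isMarked h μ hc (ih r (by omega) _ _ hc)
        rwa [← hu] at this

theorem isMarked_none_forget {n : ℕ} {t : Topo (n + 1)} (hm : isMarked none t.forget = true) :
    ∃ c₁ c₂, t = .node [c₁, c₂] ∧ isGood (some 2) c₁.forget = true ∧
      isGood (some 2) c₂.forget = true := by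
  obtain ⟨l, ht⟩ := t.exists_eq_node
  rw [ht] at hm ⊢
  simp only [isMarked, vertexDegree, nbrGood, Topo.forget_node, LTree.numChildren_node,
    LTree.mapChildren_node, decide_eq_true_eq, Option.isSome_none, Multiset.coe_card,
    List.length_map] at hm
  obtain ⟨h1, h2⟩ := hm
  obtain ⟨c₁, c₂, rfl⟩ := List.length_eq_two.1 (by simpa using h1)
  refine ⟨c₁, c₂, rfl, h2 _ ?_, h2 _ ?_⟩ <;> simp

theorem expect_rootView_pair {R : ℕ} {j : ParentInfo} {c₁ c₂ : Topo (R + 4)}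
    (hj : j = topoInfo none (Topo.node [c₁, c₂]).forget)
    (hm : isMarked none (Topo.node [c₁, c₂]).forget = true)
    (hg₁ : isGood (some 2) c₁.forget = true) (hg₂ : isGood (some 2) c₂.forget = true)
    (g : LTree VertexView (R + 2) → ℝ≥0∞) (s s₁ s₂ : ℤˣ) (b : Bool) :
    (expect (spinLaw h μ (R + 4) c₁ s₁) fun z₁ => expect (spinLaw h μ (R + 4) c₂ s₂) fun z₂ =>
      g (cutView (R + 2) (annotate none (LTree.node (s, b) (z₁ ::ₘ {z₂}))))) =
    if s₁ = -s ∧ s₂ = -s ∧ b = true then g (LTree.node ⟨j.good, true, none⟩ 0) else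
      expect (((viewLaw h μ (R + 1) (some j) c₁ s₁).bind fun v₁ =>
        (viewLaw h μ (R + 1) (some j) c₂ s₂).map fun v₂ => (v₁, v₂)).map fun v =>
          LTree.node (⟨j.good, true, none⟩ : VertexView) (v.1 ::ₘ {v.2})) g := by
  have hview : ∀ z₁ ∈ (spinLaw h μ (R + 4) c₁ s₁).support,
      ∀ z₂ ∈ (spinLaw h μ (R + 4) c₂ s₂).support,
      cutView (R + 2) (annotate none (LTree.node (s, b) (z₁ ::ₘ {z₂}))) =
      if s₁ = -s ∧ s₂ = -s ∧ b = true then LTree.node ⟨j.good, true, none⟩ 0 else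
        LTree.node (⟨j.good, true, none⟩ : VertexView) (cutView (R + 1) (annotate (some j) z₁) ::ₘ
          {cutView (R + 1) (annotate (some j) z₂)}) := by
    intro z₁ hz₁ z₂ hz₂
    have hsk₁ := skel_of_mem_support_spinLaw h μ hz₁
    have hl₁ := label_of_mem_support_spinLaw h μ hz₁
    have hsk₂ := skel_of_mem_support_spinLaw h μ hz₂
    have hl₂ := label_of_mem_support_spinLaw h μ hz₂
    set y : LTree (ℤˣ × Bool) (R + 4 + 1) := LTree.node (s, b) (z₁ ::ₘ {z₂}) with hy
    have hsk : y.skel = (Topo.node [c₁, c₂]).forget := by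
      simp only [hy, LTree.skel_node, Multiset.map_cons, Multiset.map_singleton, hsk₁, hsk₂]
      rfl
    have hmk : isMarked none y = true := by rw [← isMarked_skel, hsk, hm]
    have hmz₁ : isMarked (some j) z₁ = false := by
      rw [← isMarked_skel, hsk₁]; exact not_isMarked_of_isGood j hg₁
    have hmz₂ : isMarked (some j) z₂ = false := by
      rw [← isMarked_skel, hsk₂]; exact not_isMarked_of_isGood j hg₂
    have hgood : isGood none y = j.good := by
      rw [← isGood_skel, hsk, hj]; rfl
    have hinfo : infoForChildren none y = j.withSpin s := by
      rw [infoForChildren_eq, hsk, ← hj]; rfl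
    have hcut : isCut none y = decide (s₁ = -s ∧ s₂ = -s ∧ b = true) := by
      have hn : nbrSpins none y = s₁ ::ₘ {s₂} := by
        rw [← hl₁, ← hl₂]
        change 0 + Multiset.map _ (z₁ ::ₘ {z₂}) = _
        simp
      have hl : y.label = (s, b) := rfl
      simp only [isCut, hmk, hn, hl]
      cases b <;> simp
    have hvd : (vertexData none y).viewInner = ⟨j.good, true, none⟩ := by
      simp only [VertexData.viewInner, vertexData, hmk]
      rw [← hgood]; rfl
    by_cases hc : s₁ = -s ∧ s₂ = -s ∧ b = true
    · have hcut' : isCut none y = true := by rw [hcut]; exact decide_eq_true hc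
      rw [if_pos hc, hy, annotate_node, ← hy, cutView_node_of_cut hcut', hvd]
    · have hcut' : isCut none y = false := by rw [hcut]; simp [hc]
      rw [if_neg hc, hy, annotate_node, ← hy, cutView_node hcut', hvd, hinfo]
      congr 1
      have hch : ∀ z : LTree (ℤˣ × Bool) (R + 4), isMarked (some j) z = false →
          childView (R + 1) (annotate (some j) z) = {cutView (R + 1) (annotate (some j) z)} := by
        intro z hz
        have : (annotate (some j) z).label.cut = false := by
          rw [label_annotate]; exact isCut_eq_false hz
        simp [childView, this]
      rw [Multiset.map_cons, Multiset.map_singleton, annotate_withSpin hmz₁, annotate_withSpin hmz₂,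
        Multiset.cons_bind, Multiset.singleton_bind, hch _ hmz₁, hch _ hmz₂, Multiset.singleton_add]
  rw [expect_congr fun z₁ hz₁ => expect_congr fun z₂ hz₂ => congrArg g (hview z₁ hz₁ z₂ hz₂)]
  split_ifs with hc
  · simp
  · simp only [viewLaw, expect_map, expect_bind]

/-- A marked root has two good children. Only the cases where they agree and the root is not cut are
informative, with weights p² and q²(1 - d). The mixed cases, taken together, and the cut have the
same law for both spins and go into `J`. The contraction factor is merely bounded by 1. -/
theorem infoLE_viewLaw_of_isMarked_root {d : ℝ} (hd0 : 0 ≤ d) (hd1 : d ≤ 1)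
    (hμ : ∀ g, expect μ g = ENNReal.ofReal d * g true + ENNReal.ofReal (1 - d) * g false)
    (hp : 0 < p) {R : ℕ} {c₁ c₂ : Topo (R + 4)}
    (hm : isMarked none (Topo.node [c₁, c₂]).forget = true)
    (hg₁ : isGood (some 2) c₁.forget = true) (hg₂ : isGood (some 2) c₂.forget = true)
    {w₁ w₂ : ℝ≥0∞}
    (H₁ : InfoLE (viewLaw h μ (R + 1) (some (topoInfo none (Topo.node [c₁, c₂]).forget)) c₁) w₁)
    (H₂ : InfoLE (viewLaw h μ (R + 1) (some (topoInfo none (Topo.node [c₁, c₂]).forget)) c₂) w₂) :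
    InfoLE (viewLaw h μ (R + 2) none (Topo.node [c₁, c₂])) (w₁ + w₂) := by
  have hpq : (p : ℝ) + q = 1 := by exact_mod_cast h
  have hp' : (0 : ℝ) < p := hp
  have hp1 : (p : ℝ) ≤ 1 := by rw [← hpq]; simp
  have hq1 : (q : ℝ) ≤ 1 := by rw [← hpq]; simp
  have hd1' : 0 ≤ 1 - d := sub_nonneg.2 hd1
  obtain ⟨j, hj⟩ : ∃ j, j = topoInfo none (Topo.node [c₁, c₂]).forget := ⟨_, rfl⟩
  rw [← hj] at H₁ H₂
  let LL : ℤˣ → ℤˣ → PMF (LTree VertexView (R + 2)) := fun s₁ s₂ =>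
    ((viewLaw h μ (R + 1) (some j) c₁ s₁).bind fun v₁ =>
        (viewLaw h μ (R + 1) (some j) c₂ s₂).map fun v₂ => (v₁, v₂)).map fun v =>
          LTree.node (⟨j.good, true, none⟩ : VertexView) (v.1 ::ₘ {v.2})
  have hLL : InfoLE (fun s => LL s s) (w₁ + w₂) := (H₁.prod H₂).map _
  set z0 : LTree VertexView (R + 2) := LTree.node ⟨j.good, true, none⟩ 0 with hz0
  have key : ∀ g s s₁ s₂ b, (expect (spinLaw h μ (R + 4) c₁ s₁) fun z₁ =>
      expect (spinLaw h μ (R + 4) c₂ s₂) fun z₂ =>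
        g (cutView (R + 2) (annotate none (LTree.node (s, b) (z₁ ::ₘ {z₂}))))) =
      if s₁ = -s ∧ s₂ = -s ∧ b = true then g z0 else expect (LL s₁ s₂) g :=
    expect_rootView_pair h μ hj hm hg₁ hg₂
  clear_value LL z0
  have h1 := hLL.noisy (K := viewLaw h μ (R + 2) none (Topo.node [c₁, c₂]))
    (J := fun s g => ENNReal.ofReal (p * q) * (expect (LL s (-s)) g + expect (LL (-s) s) g) +
      ENNReal.ofReal (d * q ^ 2) * g z0)
    (A := (p : ℝ) ^ 2) (B := q ^ 2 * (1 - d)) (by positivity) (by positivity)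
    (by positivity) (fun f => by
      have hs : ∀ s₁ s₂, 2 ≤ expect (LL s₁ s₂) (fun x => ENNReal.ofReal ((1 - f x) ^ 2)) +
          expect (LL s₁ s₂) (fun x => ENNReal.ofReal ((1 + f x) ^ 2)) := fun s₁ s₂ => by
        rw [← expect_add]
        calc (2 : ℝ≥0∞) = expect (LL s₁ s₂) fun _ => 2 := by simp
          _ ≤ _ := expect_mono _ fun x => ofReal_sq_add_sq_ge (f x)
      calc ENNReal.ofReal (2 * (1 - (p : ℝ) ^ 2 - q ^ 2 * (1 - d)))
          = ENNReal.ofReal (p * q) * (2 + 2) + ENNReal.ofReal (d * q ^ 2) * 2 := by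
            rw [show (2 + 2 : ℝ≥0∞) = ENNReal.ofReal 4 by norm_num,
              show (2 : ℝ≥0∞) = ENNReal.ofReal 2 by simp, ← ENNReal.ofReal_mul (by positivity),
              ← ENNReal.ofReal_mul (by positivity), ← ENNReal.ofReal_add (by positivity)
              (by positivity)]
            congr 1
            linear_combination (-2 * ((p : ℝ) + q + 1)) * hpq
        _ ≤ ENNReal.ofReal (p * q) *
            ((expect (LL 1 (-1)) (fun x => ENNReal.ofReal ((1 - f x) ^ 2)) +
              expect (LL 1 (-1)) (fun x => ENNReal.ofReal ((1 + f x) ^ 2))) +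
            (expect (LL (-1) 1) (fun x => ENNReal.ofReal ((1 - f x) ^ 2)) +
              expect (LL (-1) 1) (fun x => ENNReal.ofReal ((1 + f x) ^ 2)))) +
            ENNReal.ofReal (d * q ^ 2) *
              (ENNReal.ofReal ((1 - f z0) ^ 2) + ENNReal.ofReal ((1 + f z0) ^ 2)) := by
            gcongr
            · exact hs _ _
            · exact hs _ _
            · exact ofReal_sq_add_sq_ge _
        _ = _ := by rw [neg_neg]; ring) ?_
  · refine h1.mono (mul_le_of_le_one_left' ?_)
    rw [ENNReal.ofReal_le_one]
    have hA : (p : ℝ) ^ 2 ≤ 1 := pow_le_one₀ p.coe_nonneg hp1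
    have hB : (q : ℝ) ^ 2 * (1 - d) ≤ 1 :=
      mul_le_one₀ (pow_le_one₀ q.coe_nonneg hq1) hd1' (by linarith)
    have hA0 : (0 : ℝ) < (p : ℝ) ^ 2 := by positivity
    have hB0 : (0 : ℝ) ≤ (q : ℝ) ^ 2 * (1 - d) := by positivity
    have hAB : (p : ℝ) ^ 2 + q ^ 2 * (1 - d) ≤ 1 := by
      nlinarith [mul_nonneg p.coe_nonneg q.coe_nonneg, sq_nonneg (q : ℝ)]
    rw [div_le_one (by positivity)]
    nlinarith [mul_nonneg hA0.le hB0]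
  · intro s g
    have e : expect (viewLaw h μ (R + 2) none (Topo.node [c₁, c₂]) s) g =
        ENNReal.ofReal d * (p * (p * expect (LL s s) g + q * expect (LL s (-s)) g) +
          q * (p * expect (LL (-s) s) g + q * g z0)) +
        ENNReal.ofReal (1 - d) * (p * (p * expect (LL s s) g + q * expect (LL s (-s)) g) +
          q * (p * expect (LL (-s) s) g + q * expect (LL (-s) (-s)) g)) := by
      have hs : s ≠ -s := by rcases Int.units_eq_one_or s with h | h <;> simp [h]
      rw [viewLaw, expect_map]
      erw [spinLaw_node]
      simp only [indepMultiset, expect_bind, expect_map, expect_pure, hμ, expect_noisySpin,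
        Multiset.cons_zero, expect_add, expect_const_mul, key]
      simp only [hs, and_false, and_self, and_true, if_true, if_false, Bool.false_eq_true]
      ring
    rw [e]
    simp only [ENNReal.ofReal_mul hd0,
      ENNReal.ofReal_mul (by positivity : (0 : ℝ) ≤ (q : ℝ) ^ 2), ENNReal.ofReal_mul p.coe_nonneg,
      ENNReal.ofReal_pow p.coe_nonneg, ENNReal.ofReal_pow q.coe_nonneg, ENNReal.ofReal_coe_nnreal]
    have hdd : ENNReal.ofReal d + ENNReal.ofReal (1 - d) = 1 := by
      rw [← ENNReal.ofReal_add hd0 hd1']; simp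
    calc _ = (ENNReal.ofReal d + ENNReal.ofReal (1 - d)) * (p * p * expect (LL s s) g)
          + (ENNReal.ofReal d + ENNReal.ofReal (1 - d)) * (p * q * expect (LL s (-s)) g)
          + (ENNReal.ofReal d + ENNReal.ofReal (1 - d)) * (p * q * expect (LL (-s) s) g)
          + ENNReal.ofReal d * q ^ 2 * g z0
          + q ^ 2 * ENNReal.ofReal (1 - d) * expect (LL (-s) (-s)) g := by ring
      _ = _ := by rw [hdd]; ring

/-- For a marked root the edge factor to its children has not been gained, which `u⁻¹` compensates.
For an unmarked root `u⁻¹ ≥ 1` does no harm. -/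
theorem infoLE_viewLaw_root {d : ℝ} (hd0 : 0 ≤ d) (hd1 : d ≤ 1)
    (hμ : ∀ g, expect μ g = ENNReal.ofReal d * g true + ENNReal.ofReal (1 - d) * g false)
    (hp : 0 < p) {u Q : ℝ≥0∞} (hu : u = ENNReal.ofReal (((p : ℝ) - q) ^ 2)) (hu1 : u ≤ 1)
    (hu0 : u ≠ 0)
    (hQ : ENNReal.ofReal ((((p : ℝ) - q) ^ 2 - d * q ^ 2) ^ 2 / (1 - d * q ^ 2)) ≤ u * Q * u)
    (r : ℕ) (t : Topo (r + 5)) :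
    InfoLE (viewLaw h μ (r + 2) none t) (u⁻¹ * pathWeight u Q (r + 1) none t) := by
  by_cases hm : isMarked none t.forget = true
  · obtain ⟨c₁, c₂, ht, hg₁, hg₂⟩ := isMarked_none_forget hm
    rw [ht] at hm ⊢
    have H := infoLE_viewLaw h μ hd0 hd1 hμ hp hu hu1 hQ r
    refine (infoLE_viewLaw_of_isMarked_root h μ hd0 hd1 hμ hp hm hg₁ hg₂
      (H _ _ (not_isMarked_of_isGood _ hg₁)) (H _ _ (not_isMarked_of_isGood _ hg₂))).mono ?_
    have hut : u ≠ ∞ := ne_top_of_le_ne_top ENNReal.one_ne_top hu1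
    simp only [pathWeight, Topo.children_node, List.map_cons, List.map_nil, List.sum_cons,
      List.sum_nil, add_zero, not_isMarked_of_isGood _ hg₁, not_isMarked_of_isGood _ hg₂,
      Bool.false_eq_true, if_false, mul_one]
    rw [← mul_add, ← mul_assoc, ENNReal.inv_mul_cancel hu0 hut, one_mul]
  · rw [Bool.not_eq_true] at hm
    refine (infoLE_viewLaw h μ hd0 hd1 hμ hp hu hu1 hQ (r + 1) none t hm).mono ?_
    exact le_mul_of_one_le_left' (ENNReal.one_le_inv.2 hu1)

end

/-! ### Comparing the weights -/

theorem pathWeight_succ_le {u Q : ℝ≥0∞} (hQ1 : Q ≤ 1) {r : ℕ} {F : Topo (r + 4) → ℝ≥0∞}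
    (H : ∀ i t, pathWeight u Q r i t ≤ F t) (i : Option ParentInfo) (t : Topo (r + 5)) :
    pathWeight u Q (r + 1) i t ≤ (t.children.map fun c => u * F c).sum := by
  rw [pathWeight]
  refine List.sum_le_sum fun c _ => mul_le_mul' (mul_le_of_le_one_right' ?_) (H _ _)
  split_ifs
  · exact hQ1
  · exact le_rfl

/-- Three leaf children have degree 1 ≠ 2, so the vertex is good whatever its parent and the
remaining subtree are. -/
theorem isGood_of_three_leaves {n : ℕ} (d : Option ℕ) (t : Topo (n + 1)) :
    isGood d (Topo.node [t, .node [], .node [], .node []]).forget = true := by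
  simp only [isGood, nbrDegrees, decide_eq_true_eq, Multiset.countP_add]
  refine le_trans ?_ le_add_self
  have : LTree.mapChildren (fun c => c.numChildren + 1)
      (Topo.node [t, .node [], .node [], .node []]).forget =
      (t.forget.numChildren + 1) ::ₘ (1 ::ₘ 1 ::ₘ 1 ::ₘ 0) := rfl
  rw [this]
  refine le_trans ?_ (Multiset.countP_le_of_le _ (Multiset.le_cons_self _ _))
  decide

theorem isMarked_of_three_leaves {n : ℕ} (i : Option ParentInfo) (t : Topo (n + 1)) :
    isMarked (some (topoInfo i (Topo.node [.node [.node [t, .node [], .node [], .node []]],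
      .node [], .node [], .node []]).forget))
      (Topo.node [.node [t, .node [], .node [], .node []]]).forget = true := by
  simp only [isMarked, decide_eq_true_eq]
  refine ⟨rfl, fun b hb => ?_⟩
  have hb' : b = isGood (i.map ParentInfo.deg) (Topo.node [.node [.node [t, .node [], .node [],
      .node []]], .node [], .node [], .node []]).forget ∨
      b = isGood (some 2) (Topo.node [t, .node [], .node [], .node []]).forget := by
    simpa using (show b ∈ ({isGood (i.map ParentInfo.deg) (Topo.node [.node [.node [t, .node [],
      .node [], .node []]], .node [], .node [], .node []]).forget} : Multiset Bool) +
      {isGood (some 2) (Topo.node [t, .node [], .node [], .node []]).forget} from hb)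
  rcases hb' with rfl | rfl
  · exact isGood_of_three_leaves _ _
  · exact isGood_of_three_leaves _ _

theorem pathWeight_three_leaves (u Q : ℝ≥0∞) (r : ℕ) (i : Option ParentInfo) (t : Topo (r + 6)) :
    pathWeight u Q (r + 3) i (Topo.node [t, .node [], .node [], .node []]) =
      u * (if isMarked (some (topoInfo i (Topo.node [t, .node [], .node [], .node []]).forget))
        t.forget then Q else 1) * pathWeight u Q (r + 2)
          (some (topoInfo i (Topo.node [t, .node [], .node [], .node []]).forget)) t := by
  have hnil : ∀ j : Option ParentInfo,
      pathWeight u Q (r + 2) j (Topo.node [] : Topo (r + 5 + 1)) = 0 := fun _ => rfl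
  generalize hτ : (Topo.node [t, .node [], .node [], .node []]).forget = τ
  have : pathWeight u Q (r + 3) i (Topo.node [t, .node [], .node [], .node []]) =
      ([t, .node [], .node [], .node []].map fun c : Topo (r + 5 + 1) =>
      u * (if isMarked (some (topoInfo i τ)) c.forget then Q else 1) *
        pathWeight u Q (r + 2) (some (topoInfo i τ)) c).sum := by
    rw [← hτ]; rfl
  rw [this]
  simp only [List.map_cons, List.map_nil, List.sum_cons, List.sum_nil, hnil, mul_zero, add_zero]

/-- Every mark is discarded at the cost of `Q ≤ 1`, except the one a gadget forces. In a gadget all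
paths reaching the required depth run through the marked vertex, since the leaf children carry none.
-/
theorem pathWeight_le_gadgetWeight {u Q : ℝ≥0∞} (hQ1 : Q ≤ 1) (r : ℕ) (i : Option ParentInfo)
    (t : Topo (r + 4)) : pathWeight u Q r i t ≤ gadgetWeight u Q r t := by
  induction r using Nat.strong_induction_on generalizing i with
  | _ r ih =>
    match r, ih with
    | 0, _ => exact le_rfl
    | 1, ih => exact pathWeight_succ_le hQ1 (fun i t => ih 0 (by norm_num) i t) i t
    | 2, ih => exact pathWeight_succ_le hQ1 (fun i t => ih 1 (by norm_num) i t) i t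
    | r + 3, ih =>
      have H1 := pathWeight_succ_le (r := r + 1) hQ1
        (pathWeight_succ_le hQ1 fun i t => ih r (by omega) i t)
      have hsum : ∀ c : Topo (r + 6), u * (c.children.map fun d => u * (d.children.map fun e =>
          u * gadgetWeight u Q r e).sum).sum =
          (c.children.map fun d => (d.children.map fun e => u ^ 3 * gadgetWeight u Q r e).sum).sum := by
        intro c
        simp only [← List.sum_map_mul_left, ← mul_assoc]
        simp only [pow_succ, pow_zero, one_mul]
      rw [gadgetWeight]
      split_ifs with hg
      · obtain ⟨t', rfl⟩ := hg
        set M : Topo (r + 6) := .node [.node [t', .node [], .node [], .node []]] with hM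
        have ht : t'.gadget = .node [M, .node [], .node [], .node []] := rfl
        rw [ht, pathWeight_three_leaves, isMarked_of_three_leaves, if_pos rfl]
        refine (mul_le_mul_right (H1 _ M) _).trans ?_
        rw [mul_comm u Q, mul_assoc, hsum M]
        exact mul_le_mul_right le_self_add _
      · rw [one_mul]
        refine (pathWeight_succ_le (r := r + 2) hQ1 H1 i t).trans (le_of_eq ?_)
        congr 2
        funext c
        exact hsum c

theorem cutProb_nonneg (ε : ℝ) : 0 ≤ cutProb ε := by
  unfold cutProb
  split_ifs <;> positivity

theorem expect_cutCoin {a b : ℝ≥0} {ε : ℝ} (hε : (flipProb a b : ℝ) = ε)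
    (g : Bool → ℝ≥0∞) :
    expect (cutCoin a b) g =
      ENNReal.ofReal (cutProb ε) * g true + ENNReal.ofReal (1 - cutProb ε) * g false := by
  rw [expect, tsum_fintype]
  simp only [cutCoin, PMF.ofFintype_apply, Fintype.sum_bool, if_true, Bool.false_eq_true, if_false,
    hε]
  rw [ENNReal.ofReal_sub _ (cutProb_nonneg ε), ENNReal.ofReal_one]

theorem semirandomModel_eq (a b : ℝ≥0) (R : ℕ) :
    semirandomModel a b R = uniformSpin.bind fun s =>
      ((broadcastTree a b (cutCoin a b) (R + 3) s).map adversaryView).map fun x => (s, x) := by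
  simp only [semirandomModel, PMF.map_comp, Function.comp_def]

/-- Truncation at 1, always a valid bound, allows `w` to be infinite. -/
theorem InfoLE.advantage_le_sqrt_min {Ω : Type} {K : ℤˣ → PMF Ω} {w : ℝ≥0∞} (H : InfoLE K w) :
    advantage (uniformSpin.bind fun s => (K s).map fun x => (s, x)) ≤ √(min w 1).toReal := by
  have h1 : InfoLE K (min w 1) := by
    rcases le_total w 1 with h | h
    · rwa [min_eq_left h]
    · rw [min_eq_right h]; exact infoLE_of_one_le K le_rfl
  have h2 : min w 1 ≠ ∞ := ne_top_of_le_ne_top ENNReal.one_ne_top (min_le_right _ _)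
  rw [← ENNReal.coe_toNNReal h2] at h1 ⊢
  exact h1.advantage_le

/-- The law of the observation in the semirandom model carries little information about the spin of
the root. -/
theorem infoLE_adversaryView {a b κ p q : ℝ≥0} (h : p + q = 1) (ha : a / 2 = κ * p)
    (hb : b / 2 = κ * q) {ε : ℝ} (hq : (q : ℝ) = ε) (hε : (flipProb a b : ℝ) = ε) (hε2 : ε < 1 / 2)
    {Q : ℝ≥0∞} (hQ1 : Q ≤ 1)
    (hQ : ENNReal.ofReal (((1 - 2 * ε) ^ 2 - cutProb ε * ε ^ 2) ^ 2 / (1 - cutProb ε * ε ^ 2)) ≤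
      ENNReal.ofReal ((1 - 2 * ε) ^ 2) * Q * ENNReal.ofReal ((1 - 2 * ε) ^ 2)) (r : ℕ) :
    InfoLE (fun s => (broadcastTree a b (cutCoin a b) (r + 2 + 3) s).map adversaryView)
      ((ENNReal.ofReal ((1 - 2 * ε) ^ 2))⁻¹ * expect (galtonWatson κ (r + 1 + 4))
        (gadgetWeight (ENNReal.ofReal ((1 - 2 * ε) ^ 2)) Q (r + 1))) := by
  have hpq : (p : ℝ) + q = 1 := by exact_mod_cast h
  have hθ : (p : ℝ) - q = 1 - 2 * ε := by linarith
  have hε0 : 0 ≤ ε := hq ▸ q.coe_nonneg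
  have hp : 0 < p := by
    have : (0 : ℝ) < p := by linarith
    exact this
  have H : ∀ t, InfoLE (viewLaw h (cutCoin a b) (r + 2) none t) _ := fun t =>
    infoLE_viewLaw_root h (cutCoin a b) (cutProb_nonneg ε) (cutProb_le_one (by linarith))
      (expect_cutCoin hε) hp (u := ENNReal.ofReal ((1 - 2 * ε) ^ 2)) (by rw [hθ])
      (by rw [ENNReal.ofReal_le_one]; nlinarith)
      (by
        have : 0 < (1 - 2 * ε) ^ 2 := by
          have : 0 < 1 - 2 * ε := by linarith
          positivity
        exact (ENNReal.ofReal_pos.2 this).ne')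
      (by rw [hθ, hq]; exact hQ) r t
  have H' := InfoLE.bind (galtonWatson κ (r + 5)) H
  have e : (fun s => (broadcastTree a b (cutCoin a b) (r + 2 + 3) s).map adversaryView) =
      fun s => (galtonWatson κ (r + 5)).bind fun t => viewLaw h (cutCoin a b) (r + 2) none t s := by
    funext s
    rw [broadcastTree_eq_bind_spinLaw h ha hb, PMF.map_bind]
    rfl
  rw [e]
  refine H'.mono ?_
  rw [expect_const_mul]
  gcongr
  exact expect_mono _ fun t => pathWeight_le_gadgetWeight hQ1 _ _ _

theorem tendsto_advantage {a b κ p q : ℝ≥0} (h : p + q = 1) (ha : a / 2 = κ * p)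
    (hb : b / 2 = κ * q) {ε : ℝ} (hq : (q : ℝ) = ε) (hε : (flipProb a b : ℝ) = ε) (hε2 : ε < 1 / 2)
    {Q Q' γ : ℝ≥0∞} (hQQ : Q + Q' ≤ 1)
    (hQ : ENNReal.ofReal (((1 - 2 * ε) ^ 2 - cutProb ε * ε ^ 2) ^ 2 / (1 - cutProb ε * ε ^ 2)) ≤
      ENNReal.ofReal ((1 - 2 * ε) ^ 2) * Q * ENNReal.ofReal ((1 - 2 * ε) ^ 2)) (hγ : γ < 1)
    (hκ : (κ * ENNReal.ofReal ((1 - 2 * ε) ^ 2)) ^ 3 ≤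
      Q' * gadgetProb κ * ENNReal.ofReal ((1 - 2 * ε) ^ 2) ^ 3 + γ) :
    Filter.Tendsto (fun R => advantage (semirandomModel a b R)) Filter.atTop (𝓝 0) := by
  rw [← Filter.tendsto_add_atTop_iff_nat 2]
  set u := ENNReal.ofReal ((1 - 2 * ε) ^ 2) with hu
  have hu0 : u ≠ 0 := by
    have : 0 < (1 - 2 * ε) ^ 2 := by
      have : 0 < 1 - 2 * ε := by linarith
      positivity
    exact (ENNReal.ofReal_pos.2 this).ne'
  have T := (Filter.tendsto_add_atTop_iff_nat 1).2
    (tendsto_expect_gadgetWeight κ (u := u) ENNReal.ofReal_ne_top hQQ hγ hκ)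
  have T1 := ENNReal.Tendsto.const_mul T (a := u⁻¹) (Or.inr (ENNReal.inv_ne_top.2 hu0))
  rw [mul_zero] at T1
  have T2 : Filter.Tendsto (fun r => √(min (u⁻¹ * expect (galtonWatson κ (r + 1 + 4))
      (gadgetWeight u Q (r + 1))) 1).toReal) Filter.atTop (𝓝 0) := by
    have T3 := T1.min (tendsto_const_nhds (x := (1 : ℝ≥0∞)))
    rw [min_eq_left zero_le_one] at T3
    have T4 := (ENNReal.tendsto_toReal ENNReal.zero_ne_top).comp T3
    have T5 := (Real.continuous_sqrt.tendsto _).comp T4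
    simpa only [Function.comp_def, ENNReal.toReal_zero, Real.sqrt_zero] using T5
  refine tendsto_of_tendsto_of_tendsto_of_le_of_le tendsto_const_nhds T2 (fun r => ?_) fun r => ?_
  · simp only [semirandomModel_eq]
    exact advantage_nonneg _
  · simp only [semirandomModel_eq]
    exact (infoLE_adversaryView h ha hb hq hε hε2 (le_self_add.trans hQQ) hQ r).advantage_le_sqrt_min

theorem gadgetProb_pos (κ : ℝ≥0) (hκ : 0 < κ) : 0 < (gadgetProb κ).toReal := by
  have h0 : ∀ n, 0 < (poisson κ n).toReal := fun n => by
    have hκ' : (0 : ℝ) < κ := hκ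
    rw [poisson_apply, ENNReal.toReal_ofReal (by positivity)]
    positivity
  have := h0 0; have := h0 1; have := h0 4
  simp only [gadgetProb, ENNReal.toReal_mul, ENNReal.toReal_pow]
  positivity

theorem gadgetProb_ne_top (κ : ℝ≥0) : gadgetProb κ ≠ ∞ := by
  simp only [gadgetProb]
  exact ENNReal.mul_ne_top (ENNReal.mul_ne_top (ENNReal.pow_ne_top (PMF.apply_ne_top _ _))
    (PMF.apply_ne_top _ _)) (ENNReal.pow_ne_top (PMF.apply_ne_top _ _))

/-- The strength `δ ε²` of the adversary, as a continuous function of `ε`. -/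
theorem cutProb_mul_sq {ε : ℝ} (h0 : 0 < ε) :
    cutProb ε * ε ^ 2 = (min ε (1 - 2 * ε)) ^ 2 := by
  unfold cutProb
  split_ifs with h
  · rw [min_eq_left (by linarith), one_mul]
  · rw [min_eq_right (by linarith)]
    field_simp

/-- Just above the Kesten–Stigum threshold the adversary reduces the growth rate below `1`. -/
theorem exists_flip_probability {k g : ℝ} (hk : 1 < k) (hg : 0 < g) :
    ∃ ε : ℝ, 0 < ε ∧ ε < 1 / 2 ∧ 1 < k * (1 - 2 * ε) ^ 2 ∧
      (k * (1 - 2 * ε) ^ 2) ^ 3 -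
        (min ε (1 - 2 * ε)) ^ 2 * (1 - (1 - 2 * ε) ^ 2) * (1 - 2 * ε) ^ 4 * g < 1 := by
  have hk0 : 0 < k := by linarith
  -- The value of 1 - 2ε at the Kesten–Stigum threshold, attained at ε = e. There the cube equals 1
  -- and the subtracted term is positive.
  set t := (√k)⁻¹ with ht
  have hs0 : 0 < √k := Real.sqrt_pos.2 hk0
  have hs1 : 1 < √k := by rw [Real.lt_sqrt zero_le_one]; linarith
  have ht0 : 0 < t := inv_pos.2 hs0
  have ht1 : t < 1 := inv_lt_one_of_one_lt₀ hs1
  have hkt : k * t ^ 2 = 1 := by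
    rw [ht, inv_pow, Real.sq_sqrt hk0.le]; field_simp
  set e := (1 - t) / 2 with he
  have he0 : 0 < e := by rw [he]; linarith
  have hte : 1 - 2 * e = t := by rw [he]; ring
  have hcont : Continuous fun ε : ℝ => (k * (1 - 2 * ε) ^ 2) ^ 3 -
        (min ε (1 - 2 * ε)) ^ 2 * (1 - (1 - 2 * ε) ^ 2) * (1 - 2 * ε) ^ 4 * g := by fun_prop
  have hval : (k * (1 - 2 * e) ^ 2) ^ 3 -
        (min e (1 - 2 * e)) ^ 2 * (1 - (1 - 2 * e) ^ 2) * (1 - 2 * e) ^ 4 * g < 1 := by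
    rw [hte, hkt]
    have h1 : 0 < min e t := lt_min he0 ht0
    have h2 : 0 < 1 - t ^ 2 := by nlinarith
    have : 0 < (min e t) ^ 2 * (1 - t ^ 2) * t ^ 4 * g := by positivity
    linarith
  -- The strict inequality persists near `e`, and approaching from the left keeps kθ² above 1.
  have hev := (hcont.tendsto e).eventually (gt_mem_nhds hval)
  have hev' := (nhdsWithin_le_nhds (s := Set.Iio e) hev)
  have hpos : ∀ᶠ ε in 𝓝[<] e, 0 < ε := nhdsWithin_le_nhds (lt_mem_nhds he0)
  obtain ⟨ε, ⟨h1, h2⟩, h3⟩ := ((Filter.Eventually.and hev' hpos).and self_mem_nhdsWithin).exists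
  have h3 : ε < e := h3
  refine ⟨ε, h2, by linarith, ?_, h1⟩
  have h4 : t < 1 - 2 * ε := by linarith
  calc 1 = k * t ^ 2 := hkt.symm
    _ < k * (1 - 2 * ε) ^ 2 := by gcongr

/-- The first summand is the extra factor `Q` of a marked vertex, relative to two plain edges. The
second is a lower bound `Q'` for the proportion lost. After clearing denominators the slack is a
positive multiple of x(θ² - x + (1 - θ²)θ²x), nonnegative because x ≤ θ². -/
theorem noise_identity {x θ : ℝ} (hθ0 : 0 < θ) (hθ1 : θ < 1) (hx0 : 0 ≤ x) (hx : x ≤ θ ^ 2) :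
    (θ ^ 2 - x) ^ 2 / (1 - x) / θ ^ 4 + x * (1 - θ ^ 2) / θ ^ 2 ≤ 1 := by
  have hθ2 : θ ^ 2 < 1 := by nlinarith
  have h1x : 0 < 1 - x := by linarith
  rw [div_div, div_add_div _ _ (by positivity) (by positivity), div_le_one (by positivity)]
  have h0 : 0 < θ ^ 2 := by positivity
  have key : (θ ^ 2 - x) ^ 2 + x * (1 - θ ^ 2) * θ ^ 2 * (1 - x) ≤ (1 - x) * θ ^ 4 := by
    have e : (1 - x) * θ ^ 4 - ((θ ^ 2 - x) ^ 2 + x * (1 - θ ^ 2) * θ ^ 2 * (1 - x)) =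
        x * (θ ^ 2 - x + (1 - θ ^ 2) * θ ^ 2 * x) := by ring
    have : 0 ≤ x * (θ ^ 2 - x + (1 - θ ^ 2) * θ ^ 2 * x) :=
      mul_nonneg hx0 (add_nonneg (by linarith)
        (mul_nonneg (mul_nonneg (by linarith) h0.le) hx0))
    linarith
  calc (θ ^ 2 - x) ^ 2 * θ ^ 2 + (1 - x) * θ ^ 4 * (x * (1 - θ ^ 2))
      = ((θ ^ 2 - x) ^ 2 + x * (1 - θ ^ 2) * θ ^ 2 * (1 - x)) * θ ^ 2 := by ring
    _ ≤ ((1 - x) * θ ^ 4) * θ ^ 2 := by gcongr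

end

theorem mainTheorem2 (k : ℝ) (hk : 1 < k) :
    ∃ ε : ℝ, 0 < ε ∧ ε < 1 / 2 ∧ 1 < k * (1 - 2 * ε) ^ 2 ∧
      (∃ f : (R : ℕ) → LTree (Option ℤˣ) R → ℤˣ, ∃ η : ℝ, 1 / 2 < η ∧
        ∀ᶠ R : ℕ in Filter.atTop,
          ENNReal.ofReal η ≤
            successProb
              (randomModel (2 * k * (1 - ε)).toNNReal (2 * k * ε).toNNReal R) (f R)) ∧
      Filter.Tendsto
        (fun R : ℕ =>
          advantage (semirandomModel (2 * k * (1 - ε)).toNNReal (2 * k * ε).toNNReal R))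
        Filter.atTop (𝓝 0) := by
  have hk0 : 0 < k := by linarith
  have hg : 0 < (gadgetProb k.toNNReal).toReal := gadgetProb_pos _ (by simpa using hk0)
  obtain ⟨ε, hε0, hε1, hKS, hF⟩ := exists_flip_probability hk hg
  have ha0 : 0 ≤ 2 * k * (1 - ε) := by
    have : 0 ≤ 1 - ε := by linarith
    positivity
  have hb0 : 0 ≤ 2 * k * ε := by positivity
  have hac : (((2 * k * (1 - ε)).toNNReal : ℝ≥0) : ℝ) = 2 * k * (1 - ε) := Real.coe_toNNReal _ ha0
  have hbc : (((2 * k * ε).toNNReal : ℝ≥0) : ℝ) = 2 * k * ε := Real.coe_toNNReal _ hb0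
  set a := (2 * k * (1 - ε)).toNNReal
  set b := (2 * k * ε).toNNReal
  refine ⟨ε, hε0, hε1, hKS, ?_, ?_⟩
  · obtain ⟨f, η, hη, hf⟩ := exists_randomModel_estimator (a := a) (b := b)
      (by rw [← NNReal.coe_lt_coe, hac, hbc]; nlinarith)
      -- Here (a + b)/2 = k and (a - b)/2 = k(1 - 2ε), so the condition is `hKS` multiplied by k.
      (by rw [hac, hbc]; nlinarith)
    exact ⟨f, η, hη, Filter.Eventually.of_forall hf⟩
  · set θ := 1 - 2 * ε with hθ
    have hθ0 : 0 < θ := by linarith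
    have hθ1 : θ < 1 := by linarith
    set x := (min ε θ) ^ 2 with hx
    have hm0 : 0 < min ε θ := lt_min hε0 hθ0
    have hx0 : 0 ≤ x := sq_nonneg _
    have hxθ : x ≤ θ ^ 2 := by
      rw [hx]; gcongr; exact min_le_right _ _
    have hθ2 : θ ^ 2 < 1 := by nlinarith
    have h1x : 0 < 1 - x := by linarith
    have hcx : cutProb ε * ε ^ 2 = x := cutProb_mul_sq hε0
    have hkc : (k.toNNReal : ℝ) = k := Real.coe_toNNReal _ hk0.le
    have hec : (ε.toNNReal : ℝ) = ε := Real.coe_toNNReal _ hε0.le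
    have hpc : ((1 - ε).toNNReal : ℝ) = 1 - ε := Real.coe_toNNReal _ (by linarith)
    have hq0 : 0 ≤ (θ ^ 2 - x) ^ 2 / (1 - x) / θ ^ 4 := by positivity
    have hq0' : 0 ≤ x * (1 - θ ^ 2) / θ ^ 2 :=
      div_nonneg (mul_nonneg hx0 (by linarith)) (by positivity)
    set F := (k * θ ^ 2) ^ 3 - x * (1 - θ ^ 2) * θ ^ 4 * (gadgetProb k.toNNReal).toReal
    refine tendsto_advantage (κ := k.toNNReal) (p := (1 - ε).toNNReal) (q := ε.toNNReal) (ε := ε)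
      (Q := ENNReal.ofReal ((θ ^ 2 - x) ^ 2 / (1 - x) / θ ^ 4))
      (Q' := ENNReal.ofReal (x * (1 - θ ^ 2) / θ ^ 2)) (γ := ENNReal.ofReal F)
      ?_ ?_ ?_ hec ?_ hε1 ?_ ?_ ?_ ?_
    · rw [← NNReal.coe_inj]; push_cast; rw [hec, hpc]; ring
    · rw [← NNReal.coe_inj]; push_cast; rw [hac, hkc, hpc]; ring
    · rw [← NNReal.coe_inj]; push_cast; rw [hbc, hkc, hec]; ring
    · rw [flipProb]; push_cast; rw [hac, hbc]; field_simp; ring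
    · rw [← ENNReal.ofReal_add hq0 hq0', ENNReal.ofReal_le_one]
      exact noise_identity hθ0 hθ1 hx0 hxθ
    · rw [hcx, ← hθ, ← ENNReal.ofReal_mul (by positivity), ← ENNReal.ofReal_mul (by positivity)]
      refine ENNReal.ofReal_le_ofReal (le_of_eq ?_)
      field_simp
    · rw [ENNReal.ofReal_lt_one]; exact hF
    · rw [← hθ, ← ENNReal.ofReal_coe_nnreal, hkc, ← ENNReal.ofReal_toReal (gadgetProb_ne_top _),
        ← ENNReal.ofReal_mul hk0.le, ← ENNReal.ofReal_pow (by positivity),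
        ← ENNReal.ofReal_pow (by positivity), ← ENNReal.ofReal_mul hq0',
        ← ENNReal.ofReal_mul (by positivity)]
      -- The bound `ENNReal.ofReal_add_le` needs no sign condition, so it does not matter whether
      -- `F` is negative.
      refine le_trans (ENNReal.ofReal_le_ofReal (le_of_eq ?_)) ENNReal.ofReal_add_le
      simp only [F]
      field_simp
      ring
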